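/- Let $\mathbb T=\mathbb R/\mathbb Z$ with Lebesgue measure $\lambda$. Let $\mathrm{Diff}^1_+(\mathbb T)$ be the group of orientation-preserving $C^1$ diffeomorphisms of $\mathbb T$ with the Borel structure of the $C^1$ topology, and let $\mathrm{HomeoLeb}_+(\mathbb T)$ be the group of orientation-preserving homeomorphisms $\phi$ of $\mathbb T$ such that $\phi_*\lambda$ and $\lambda$ have the same null sets, with the Borel structure of the topology of uniform convergence; it contains $\mathrm{Diff}^1_+(\mathbb T)$. Let $G$ be a locally compact (Hausdorff) group with Kazhdan's property $(T)$, meaning that for every strongly continuous unitary representation $\rho$ of $G$ on a complex Hilbert space $V$ there is a compact set $C\subseteq G$ such that for every $\varepsilon>0$ there is $\delta>0$ with the following property: if $v\in V$ satisfies $\|\rho(g)v-v\|\le\delta\|v\|$ for all $g\in C$, then there is a $\rho(G)$-invariant $w\in V$ with $\|w\|=\|v\|$ and $\|w-v\|\le\varepsilon\|v\|$. Let $M$ be a standard Borel space with a Borel action $G\times M\to M$ and a nonzero finite $G$-invariant measure $\mu$. Let $\alpha\colon G\times M\to\mathrm{Diff}^1_+(\mathbb T)$ be a Borel cocycle, that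 is, a Borel map such that for all $g,h\in G$ one has $\alpha(gh,m)=\alpha(g,hm)\,\alpha(h,m)$ for $\mu$-a.e. $m\in M$. Suppose that there is a measurable map $f\colon M\to\mathbb T$ that is $\alpha$-equivariant, that is, for each $g\in G$ one has $f(gm)=\alpha(g,m)f(m)$ for $\mu$-a.e. $m\in M$. Then there is a $G$-invariant probability measure $\nu$ on the skew product $M\times_\alpha\mathbb T$ that has the same null sets as $\mu\times\lambda$; invariance means that for each $g\in G$ the map $(m,s)\mapsto(gm,\alpha(g,m)s)$ of $M\times\mathbb T$ preserves $\nu$. Moreover, as a cocycle into $\mathrm{HomeoLeb}_+(\mathbb T)$, $\alpha$ is cohomologous to the trivial cocycle: there is a Borel map $\phi\colon M\to\mathrm{HomeoLeb}_+(\mathbb T)$ such that for each $g\in G$ one has $\phi(gm)^{-1}\,\alpha(g,m)\,\phi(m)=1$ for $\mu$-a.e. $m\in M$. -/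

import Mathlib

open MeasureTheory

noncomputable section

/-- Kazhdan's property (T) for a topological group `G`.  A unitary representation is a homomorphism
`ρ` from `G` to the unitary operators of a complex Hilbert space that is strongly continuous. -/
def KazhdanPropertyT.{u} (G : Type u) [Group G] [TopologicalSpace G] : Prop :=
  ∀ (V : Type u) [NormedAddCommGroup V] [InnerProductSpace ℂ V] [CompleteSpace V]
    (ρ : G →* (V ≃ₗᵢ[ℂ] V)), (∀ v : V, Continuous fun g => ρ g v) →
    ∃ C : Set G, IsCompact C ∧ ∀ ε : ℝ, 0 < ε → ∃ δ : ℝ, 0 < δ ∧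
      ∀ v : V, (∀ g ∈ C, ‖ρ g v - v‖ ≤ δ * ‖v‖) →
        ∃ w : V, (∀ g, ρ g w = w) ∧ ‖w‖ = ‖v‖ ∧ ‖w - v‖ ≤ ε * ‖v‖

section Cocycles

variable {G M H : Type*} [Group G] [MulAction G M] [MeasurableSpace G] [MeasurableSpace M]
  [Group H] [MeasurableSpace H]

/-- Borel cocycles `α : G × M → H` for an action of `G` on `(M, μ)`. -/
def IsBorelCocycle (μ : Measure M) (α : G × M → H) : Prop :=
  Measurable α ∧ ∀ g h : G, ∀ᵐ m ∂μ, α (g * h, m) = α (g, h • m) * α (h, m)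

/-- `α` and `β` are cohomologous: `β(g,m) = φ(gm)⁻¹ α(g,m) φ(m)` for some Borel `φ : M → H`. -/
def Cohomologous (μ : Measure M) (α β : G × M → H) : Prop :=
  ∃ φ : M → H, Measurable φ ∧
    ∀ g : G, ∀ᵐ m ∂μ, β (g, m) = (φ (g • m))⁻¹ * α (g, m) * φ m

end Cocycles

/-- `F` is an increasing lift to `ℝ` of the homeomorphism `φ` of the circle `ℝ/ℤ`. -/
def IsIncreasingLift (F : ℝ ≃o ℝ) (φ : UnitAddCircle ≃ₜ UnitAddCircle) : Prop :=
  ∀ x : ℝ, φ (x : UnitAddCircle) = (F x : UnitAddCircle)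

theorem IsIncreasingLift.mul {F F' : ℝ ≃o ℝ} {φ φ' : UnitAddCircle ≃ₜ UnitAddCircle}
    (h : IsIncreasingLift F φ) (h' : IsIncreasingLift F' φ') :
    IsIncreasingLift (F'.trans F) (φ * φ') := fun x => by
  rw [Homeomorph.mul_apply, h' x, h (F' x)]; rfl

theorem IsIncreasingLift.inv {F : ℝ ≃o ℝ} {φ : UnitAddCircle ≃ₜ UnitAddCircle}
    (h : IsIncreasingLift F φ) : IsIncreasingLift F.symm φ⁻¹ := fun x => by
  rw [Homeomorph.inv_apply, Homeomorph.symm_apply_eq, h, OrderIso.apply_symm_apply]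

theorem isIncreasingLift_one : IsIncreasingLift (OrderIso.refl ℝ) 1 := fun _ => rfl

/-- Two increasing lifts of the same homeomorphism have the same derivative. -/
theorem IsIncreasingLift.deriv_eq {F F' : ℝ ≃o ℝ} {φ : UnitAddCircle ≃ₜ UnitAddCircle}
    (h : IsIncreasingLift F φ) (h' : IsIncreasingLift F' φ) :
    deriv (F : ℝ → ℝ) = deriv (F' : ℝ → ℝ) := by
  have hint : ∀ x, ∃ n : ℤ, (n : ℝ) = F x - F' x := fun x => by
    have : ((F x - F' x : ℝ) : UnitAddCircle) = 0 := by
      rw [AddCircle.coe_sub, ← h x, ← h' x, sub_self]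
    obtain ⟨n, hn⟩ := (AddCircle.coe_eq_zero_iff (1 : ℝ)).1 this
    exact ⟨n, by simpa using hn⟩
  choose n hn using hint
  have hc : Continuous fun x => (n x : ℝ) := by
    simp only [hn]
    exact F.continuous.sub F'.continuous
  have hc' : Continuous n := Int.isClosedEmbedding_coe_real.isInducing.continuous_iff.2 hc
  have hconst : ∀ x, n x = n 0 := fun x => PreconnectedSpace.constant inferInstance hc'
  have : (F : ℝ → ℝ) = fun x => F' x + (n 0 : ℝ) := by
    funext x
    have := hn x
    rw [hconst x] at this
    linarith
  rw [this]
  funext x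
  exact deriv_add_const (n 0 : ℝ)

/-- `Diff¹₊(𝕋)`: orientation-preserving homeomorphisms of `𝕋 = ℝ/ℤ` that are of class `C¹`
together with their inverse, as one sees on a lift to `ℝ`. -/
def Diff1Plus : Subgroup (UnitAddCircle ≃ₜ UnitAddCircle) where
  carrier := {φ | ∃ F : ℝ ≃o ℝ, IsIncreasingLift F φ ∧
    ContDiff ℝ 1 (F : ℝ → ℝ) ∧ ContDiff ℝ 1 (F.symm : ℝ → ℝ)}
  mul_mem' := by
    rintro φ φ' ⟨F, hF, hF1, hF2⟩ ⟨F', hF', hF1', hF2'⟩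
    exact ⟨F'.trans F, hF.mul hF', hF1.comp hF1', hF2'.comp hF2⟩
  one_mem' := ⟨OrderIso.refl ℝ, isIncreasingLift_one, contDiff_id, contDiff_id⟩
  inv_mem' := by
    rintro φ ⟨F, hF, hF1, hF2⟩
    exact ⟨F.symm, hF.inv, hF2, hF1⟩

/-- The derivative of a diffeomorphism of `𝕋 = ℝ/ℤ`, as a continuous function on `ℝ` (it is
`1`-periodic, and it does not depend on the lift, by `IsIncreasingLift.deriv_eq`). -/
def Diff1Plus.derivative (φ : Diff1Plus) : C(ℝ, ℝ) :=
  ⟨deriv (φ.2.choose : ℝ → ℝ), φ.2.choose_spec.2.1.continuous_deriv le_rfl⟩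

/-- The `C¹` topology on `Diff¹₊(𝕋)`: uniform convergence of `φ` and of its derivative.  (The
compact-open topology on `C(ℝ, ℝ)` is uniform convergence for `1`-periodic functions.) -/
instance Diff1Plus.topologicalSpace : TopologicalSpace Diff1Plus :=
  TopologicalSpace.induced
    (fun φ : Diff1Plus => ((⟨φ.1, φ.1.continuous⟩ : C(UnitAddCircle, UnitAddCircle)),
      Diff1Plus.derivative φ)) instTopologicalSpaceProd

/-- The Borel structure of `Diff¹₊(𝕋)`. -/
instance Diff1Plus.measurableSpace : MeasurableSpace Diff1Plus := borel Diff1Plus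

/-- `HomeoLeb₊(𝕋)`: orientation-preserving homeomorphisms `φ` of `𝕋` such that `φ_* λ` has the
same null sets as the Lebesgue measure `λ`. -/
def HomeoLebPlus : Subgroup (UnitAddCircle ≃ₜ UnitAddCircle) where
  carrier := {φ | (∃ F : ℝ ≃o ℝ, IsIncreasingLift F φ) ∧
    (volume : Measure UnitAddCircle).map φ ≪ volume ∧
    (volume : Measure UnitAddCircle) ≪ volume.map φ}
  mul_mem' := by
    rintro φ φ' ⟨⟨F, hF⟩, h1, h2⟩ ⟨⟨F', hF'⟩, h1', h2'⟩
    have e : (volume : Measure UnitAddCircle).map (φ * φ' : UnitAddCircle ≃ₜ UnitAddCircle)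
        = (volume.map φ').map φ := by
      rw [Measure.map_map φ.measurable φ'.measurable]; rfl
    refine ⟨⟨F'.trans F, hF.mul hF'⟩, ?_, ?_⟩
    · rw [e]; exact (h1'.map φ.measurable).trans h1
    · rw [e]; exact h2.trans (h2'.map φ.measurable)
  one_mem' := by
    have e : (volume : Measure UnitAddCircle).map (1 : UnitAddCircle ≃ₜ UnitAddCircle)
        = volume := Measure.map_id
    refine ⟨⟨OrderIso.refl ℝ, isIncreasingLift_one⟩, ?_, ?_⟩ <;> rw [e]
  inv_mem' := by
    rintro φ ⟨⟨F, hF⟩, h1, h2⟩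
    have e : (volume.map φ).map (φ⁻¹ : UnitAddCircle ≃ₜ UnitAddCircle)
        = (volume : Measure UnitAddCircle) := by
      rw [Measure.map_map (φ⁻¹).measurable φ.measurable]
      have : (φ⁻¹ : UnitAddCircle ≃ₜ UnitAddCircle) ∘ φ = id := by
        funext x; exact φ.symm_apply_apply x
      rw [this, Measure.map_id]
    refine ⟨⟨F.symm, hF.inv⟩, ?_, ?_⟩
    · have := h2.map (φ⁻¹).measurable
      rwa [e] at this
    · have := h1.map (φ⁻¹).measurable
      rwa [e] at this

/-- The topology of uniform convergence on `HomeoLeb₊(𝕋)`. -/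
instance HomeoLebPlus.topologicalSpace : TopologicalSpace HomeoLebPlus :=
  TopologicalSpace.induced
    (fun φ : HomeoLebPlus => (⟨φ.1, φ.1.continuous⟩ : C(UnitAddCircle, UnitAddCircle)))
    ContinuousMap.compactOpen

/-- The Borel structure of `HomeoLeb₊(𝕋)`. -/
instance HomeoLebPlus.measurableSpace : MeasurableSpace HomeoLebPlus := borel HomeoLebPlus

/-- The covering map `ℝ → ℝ/ℤ` pulls null sets back to null sets. -/
theorem volume_preimage_coe_eq_zero {s : Set UnitAddCircle} (hs : volume s = 0) :
    volume ((fun x : ℝ => (x : UnitAddCircle)) ⁻¹' s) = 0 := by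
  rw [← Measure.restrict_univ (μ := (volume : Measure ℝ)), ← iUnion_Ioc_intCast ℝ]
  refine le_antisymm ((Measure.restrict_iUnion_le _).trans ?_) zero_le
  rw [Measure.sum_apply_of_countable, nonpos_iff_eq_zero, ENNReal.tsum_eq_zero]
  exact fun n => (UnitAddCircle.measurePreserving_mk (n : ℝ)).quasiMeasurePreserving.preimage_null hs

theorem Diff1Plus.map_volume_absolutelyContinuous {φ : UnitAddCircle ≃ₜ UnitAddCircle}
    (hφ : φ ∈ Diff1Plus) : (volume : Measure UnitAddCircle).map φ ≪ volume := by
  obtain ⟨F, hF, -, hF2⟩ := hφ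
  refine Measure.AbsolutelyContinuous.mk fun s hs h0 => ?_
  rw [Measure.map_apply φ.measurable hs,
    ← (UnitAddCircle.measurePreserving_mk 0).measure_preimage
      (φ.measurable hs).nullMeasurableSet]
  refine Measure.restrict_le_self.absolutelyContinuous ?_
  have e : (fun x : ℝ => (x : UnitAddCircle)) ⁻¹' (φ ⁻¹' s)
      = F.symm '' ((fun x : ℝ => (x : UnitAddCircle)) ⁻¹' s) := by
    ext x
    constructor
    · intro hx
      exact ⟨F x, by simpa only [Set.mem_preimage, hF x] using hx, F.symm_apply_apply x⟩
    · rintro ⟨y, hy, rfl⟩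
      change φ (F.symm y : UnitAddCircle) ∈ s
      rw [hF (F.symm y), OrderIso.apply_symm_apply]
      exact hy
  rw [e]
  exact addHaar_image_eq_zero_of_differentiableOn_of_addHaar_eq_zero volume
    (hF2.differentiable (by norm_num)).differentiableOn (volume_preimage_coe_eq_zero h0)

theorem diff1Plus_le_homeoLebPlus : Diff1Plus ≤ HomeoLebPlus := by
  intro φ hφ
  obtain ⟨F, hF, -, -⟩ := id hφ
  refine ⟨⟨F, hF⟩, Diff1Plus.map_volume_absolutelyContinuous hφ, ?_⟩
  have h := (Diff1Plus.map_volume_absolutelyContinuous (Diff1Plus.inv_mem hφ)).map φ.measurable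
  rw [Measure.map_map φ.measurable (φ⁻¹).measurable] at h
  have e : φ ∘ (φ⁻¹ : UnitAddCircle ≃ₜ UnitAddCircle) = id := by
    funext x; exact φ.apply_symm_apply x
  rwa [e, Measure.map_id] at h

/-- The inclusion homomorphism `Diff¹₊(𝕋) → HomeoLeb₊(𝕋)`. -/
def Diff1Plus.toHomeoLeb : Diff1Plus →* HomeoLebPlus :=
  Subgroup.inclusion diff1Plus_le_homeoLebPlus

section SkewProduct

variable {G M : Type*} [Group G] [MulAction G M] [MeasurableSpace M]

/-- The map `f : M → 𝕋` is `α`-equivariant: for each `g`, `f(gm) = α(g,m) f(m)` for a.e. `m`. -/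
def IsEquivariantMap (μ : Measure M) (α : G × M → Diff1Plus) (f : M → UnitAddCircle) : Prop :=
  ∀ g : G, ∀ᵐ m ∂μ, f (g • m) = (α (g, m)).1 (f m)

/-- The transformation `(m, s) ↦ (gm, α(g,m) s)` of `M × 𝕋` by which `g` acts on the skew product
`M ×_α 𝕋`. -/
def skewMap (α : G × M → Diff1Plus) (g : G) (p : M × UnitAddCircle) : M × UnitAddCircle :=
  (g • p.1, (α (g, p.1)).1 p.2)

/-- `ν` is a `G`-invariant probability measure on `M ×_α 𝕋` that has the same null sets as the
product of `μ` and Lebesgue measure.  (For such `ν`, changing each `α(g,·)` on a `μ`-null set does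
not affect invariance, so `α` need only satisfy the cocycle identity almost everywhere.) -/
structure IsInvariantProbEquivProd (μ : Measure M) (α : G × M → Diff1Plus)
    (ν : Measure (M × UnitAddCircle)) : Prop where
  isProbabilityMeasure : IsProbabilityMeasure ν
  measurePreserving : ∀ g : G, MeasurePreserving (skewMap α g) ν ν
  absolutelyContinuous : ν ≪ μ.prod volume
  absolutelyContinuous' : μ.prod volume ≪ ν

end SkewProduct

end

/-!
Let `f` be the equivariant map. Cutting each circle `{m} × 𝕋` open at `f m` (`cutOpen`) turns `α`
into a cocycle `β` of `C¹` diffeomorphisms of `[0, 1]` which fix the end points. Everything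
follows from a finite invariant measure on `M × [0, 1]` that is equivalent to `μ × λ`
(`IntervalCocycle.exists_invariant_density`). After dividing its density by the masses of the
fibres, which form an invariant function on `M`, the fibre measures are probability measures that
`β(g, m)` carries from the fibre over `m` to the fibre over `gm`. Moving the base point to `f m`
and straightening the fibre measures to Lebesgue measure by their distribution functions
conjugates `α` to the trivial cocycle (`cohomologous_one_of_unitDensity`).

For the invariant measure, `G` acts unitarily on the half-densities `L²(μ × λ)`. An invariant
vector `w` gives the finite invariant measure `|w|²`; combining a dense sequence of them gives
one, `ψ`, of maximal support (`NonsingularAction.exists_maximal_invariant_density`). Suppose that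
the invariant set `B = {ψ = 0}` is not null. Near the fixed end point a diffeomorphism is close to
a linear map, and the measure `dh / h` on the half-line is invariant under linear maps; so
measures that spread out along `dh / h` near the end point are almost invariant. This is made to
work inside `B` by taking for `h(x)` the Lebesgue measure of the part of the fibre of `B` to the
left of `x`: since `B` is invariant, `β` acts on this coordinate by integrating its derivative, so
that the derivative in the coordinate `h` tends to a constant at the left end of the fibre,
however thin `B` is there (`tendsto_lintegral_rpow_sub`). The densities are `s h ^ (s - 1)` with
`s → 0`, whose masses stay away from `0` and `∞`. Their square roots form a sequence of vectors
that is almost invariant under each element of `G`, and property (T) gives an invariant vector so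
close to one of them that it cannot vanish on `B`, which contradicts the choice of `ψ`.

Property (T) asks for almost invariance uniformly on a compact subset of `G`. That pointwise
almost invariance suffices follows from Baire's theorem (`eventually_forall_le_of_isCompact`), and
strong continuity of the representation from its measurability, by Steinhaus' theorem
(`continuous_orbit_of_measurable`). The group need not be second countable for either.
-/

noncomputable section

/-! ### Almost invariant vectors and property (T) -/

section Representations

open Filter Topology

/-- Continuous length-like functions on a locally compact group that tend to zero pointwise tend to
zero uniformly on compact sets; the reason is Baire's theorem. -/
theorem eventually_forall_le_of_isCompact {G : Type*} [Group G] [TopologicalSpace G]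
    [IsTopologicalGroup G] [LocallyCompactSpace G] [T2Space G] {d : ℕ → G → ℝ}
    (hc : ∀ k, Continuous (d k)) (hmul : ∀ k g h, d k (g * h) ≤ d k g + d k h)
    (hinv : ∀ k g, d k g⁻¹ = d k g) (hd : ∀ g, Tendsto (fun k => d k g) atTop (𝓝 0))
    {C : Set G} (hC : IsCompact C) {δ : ℝ} (hδ : 0 < δ) :
    ∀ᶠ k in atTop, ∀ g ∈ C, d k g ≤ δ := by
  have hsmall : ∀ g, ∃ n, ∀ k ≥ n, d k g ≤ δ / 3 := fun g =>
    eventually_atTop.1 ((hd g).eventually (ge_mem_nhds (by positivity)))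
  let F : ℕ → Set G := fun n => ⋂ k ≥ n, {g | d k g ≤ δ / 3}
  have hF : ∀ n, IsClosed (F n) := fun n =>
    isClosed_biInter fun k _ => isClosed_le (hc k) continuous_const
  have hU : ⋃ n, F n = Set.univ := by
    refine Set.eq_univ_of_forall fun g => ?_
    obtain ⟨n, hn⟩ := hsmall g
    exact Set.mem_iUnion.2 ⟨n, by simpa [F] using hn⟩
  obtain ⟨n, g₀, hg₀⟩ := nonempty_interior_of_iUnion_of_closed hF hU
  have hU : ∀ᶠ u in 𝓝 (1 : G), ∀ k ≥ n, d k u ≤ 2 * δ / 3 := by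
    have ht : Tendsto (fun u : G => g₀ * u) (𝓝 1) (𝓝 g₀) :=
      (continuous_const_mul g₀).tendsto' _ _ (mul_one _)
    filter_upwards [ht.eventually (mem_interior_iff_mem_nhds.1 hg₀)] with u hu k hk
    have h1 : d k g₀ ≤ δ / 3 := by
      have := interior_subset hg₀
      exact Set.mem_iInter₂.1 this k hk
    have h2 : d k (g₀ * u) ≤ δ / 3 := Set.mem_iInter₂.1 hu k hk
    have h3 := hmul k g₀⁻¹ (g₀ * u)
    rw [inv_mul_cancel_left, hinv] at h3
    linarith
  refine hC.induction_on (p := fun S => ∀ᶠ k in atTop, ∀ g ∈ S, d k g ≤ δ)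
    (by simp) (fun S T hST h => h.mono fun k hk g hg => hk g (hST hg))
    (fun S T hS hT => ?_) fun x _ => ?_
  · filter_upwards [hS, hT] with k h1 h2 g hg
    exact hg.elim (h1 g) (h2 g)
  · obtain ⟨n', hn'⟩ := hsmall x
    have ht : Tendsto (fun y : G => x⁻¹ * y) (𝓝 x) (𝓝 1) :=
      (continuous_const_mul x⁻¹).tendsto' _ _ (inv_mul_cancel _)
    refine ⟨_, mem_nhdsWithin_of_mem_nhds (ht.eventually hU), ?_⟩
    filter_upwards [eventually_ge_atTop n, eventually_ge_atTop n'] with k hk hk' y hy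
    have h1 := hmul k x (x⁻¹ * y)
    rw [mul_inv_cancel_left] at h1
    have h2 := hy k hk
    have h3 := hn' k hk'
    linarith

theorem unitaryRep_mul_apply {G V : Type*} [Group G] [NormedAddCommGroup V] [InnerProductSpace ℂ V]
    (ρ : G →* (V ≃ₗᵢ[ℂ] V)) (g h : G) (v : V) : ρ (g * h) v = ρ g (ρ h v) := by
  rw [map_mul]; rfl

theorem unitaryRep_apply_inv_apply {G V : Type*} [Group G] [NormedAddCommGroup V]
    [InnerProductSpace ℂ V] (ρ : G →* (V ≃ₗᵢ[ℂ] V)) (g : G) (v : V) : ρ g (ρ g⁻¹ v) = v := by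
  rw [← unitaryRep_mul_apply, mul_inv_cancel, map_one]; rfl

/-- A measurable unitary representation of a locally compact group on a separable Hilbert space is
strongly continuous, by Steinhaus' theorem. -/
theorem continuous_orbit_of_measurable {G : Type*} [Group G] [TopologicalSpace G]
    [IsTopologicalGroup G] [LocallyCompactSpace G] [MeasurableSpace G]
    [BorelSpace G] {V : Type*} [NormedAddCommGroup V] [InnerProductSpace ℂ V]
    [TopologicalSpace.SeparableSpace V] (ρ : G →* (V ≃ₗᵢ[ℂ] V)) (v : V)
    (hm : ∀ (x : V) (r : ℝ), MeasurableSet {g | ‖ρ g⁻¹ v - x‖ < r}) :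
    Continuous fun g => ρ g v := by
  have key : ∀ ε > 0, ∀ᶠ g in 𝓝 (1 : G), ‖ρ g v - v‖ < ε := by
    intro ε hε
    obtain ⟨K, hK, hK1⟩ := exists_compact_mem_nhds (1 : G)
    let μ : Measure G := Measure.haar
    let E : ℕ → Set G := fun n => {g | ‖ρ g⁻¹ v - TopologicalSpace.denseSeq V n‖ < ε / 2}
    obtain ⟨n, hn⟩ : ∃ n, 0 < μ (interior K ∩ E n) := by
      by_contra! h
      have h0 : μ (interior K) = 0 := by
        refine measure_mono_null (t := ⋃ n, interior K ∩ E n) (fun g hg => ?_)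
          (measure_iUnion_null fun n => nonpos_iff_eq_zero.1 (h n))
        obtain ⟨_, hx, ⟨n, rfl⟩⟩ := Metric.dense_iff.1
          (TopologicalSpace.denseRange_denseSeq V) (ρ g⁻¹ v) (ε / 2) (by positivity)
        refine Set.mem_iUnion.2 ⟨n, hg, ?_⟩
        rwa [Metric.mem_ball, dist_comm, dist_eq_norm] at hx
      exact (isOpen_interior.measure_pos μ ⟨1, mem_interior_iff_mem_nhds.2 hK1⟩).ne' h0
    have hfin : μ (interior K ∩ E n) ≠ ⊤ :=
      ne_top_of_le_ne_top hK.measure_ne_top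
        (measure_mono (Set.inter_subset_left.trans interior_subset))
    filter_upwards [Measure.div_mem_nhds_one_of_haar_pos_ne_top μ _
      (isOpen_interior.measurableSet.inter (hm _ _)) hn hfin] with g hg
    obtain ⟨a, ⟨-, ha⟩, b, ⟨-, hb⟩, rfl⟩ := Set.mem_div.1 hg
    have e : ρ (a / b) v - v = ρ a (ρ b⁻¹ v - ρ a⁻¹ v) := by
      rw [map_sub, div_eq_mul_inv, unitaryRep_mul_apply, unitaryRep_apply_inv_apply]
    rw [e, LinearIsometryEquiv.norm_map]
    calc ‖ρ b⁻¹ v - ρ a⁻¹ v‖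
        = ‖(ρ b⁻¹ v - TopologicalSpace.denseSeq V n)
            - (ρ a⁻¹ v - TopologicalSpace.denseSeq V n)‖ := by congr 1; abel
      _ ≤ _ := norm_sub_le _ _
      _ < ε / 2 + ε / 2 := add_lt_add hb ha
      _ = ε := add_halves ε
  refine continuous_iff_continuousAt.2 fun g₀ => Metric.tendsto_nhds.2 fun ε hε => ?_
  have ht : Tendsto (fun g : G => g₀⁻¹ * g) (𝓝 g₀) (𝓝 1) :=
    (continuous_const_mul g₀⁻¹).tendsto' _ _ (inv_mul_cancel _)
  filter_upwards [ht.eventually (key ε hε)] with g hg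
  have e : ρ g v - ρ g₀ v = ρ g₀ (ρ (g₀⁻¹ * g) v - v) := by
    rw [map_sub, ← unitaryRep_mul_apply, mul_inv_cancel_left]
  rwa [dist_eq_norm, e, LinearIsometryEquiv.norm_map]

/-- A separable Hilbert space is isometric to a Hilbert space in any prescribed universe. -/
theorem exists_hilbertBasis_shrink.{u, v} (V : Type v) [NormedAddCommGroup V]
    [InnerProductSpace ℂ V] [CompleteSpace V] [TopologicalSpace.SeparableSpace V] :
    ∃ ι : Type u, Nonempty (HilbertBasis ι ℂ V) := by
  obtain ⟨w, b, -⟩ := exists_hilbertBasis ℂ V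
  have : Countable w := by
    have hd : Pairwise fun i j : w => Disjoint (Metric.ball (b i) (1 / 2))
        (Metric.ball (b j) (1 / 2)) := by
      intro i j hij
      refine Metric.ball_disjoint_ball ?_
      have h := b.orthonormal.inner_eq_zero hij
      have h2 := norm_sub_sq (𝕜 := ℂ) (b i) (b j)
      rw [b.orthonormal.1, b.orthonormal.1, h, map_zero] at h2
      rw [dist_eq_norm]
      nlinarith [norm_nonneg (b i - b j)]
    exact Pairwise.countable_of_isOpen_disjoint hd (fun i => Metric.isOpen_ball)
      fun i => Metric.nonempty_ball.2 (by norm_num)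
  refine ⟨Shrink.{u} w, ⟨HilbertBasis.mk
    (b.orthonormal.comp _ (equivShrink.{u} w).symm.injective) ?_⟩⟩
  rw [(equivShrink.{u} w).symm.surjective.range_comp]
  exact b.dense_span.ge

/-- For a group with property (T), a strongly continuous unitary representation on a separable
Hilbert space (in any universe) that has a sequence of vectors which is almost invariant under each
group element has an invariant vector close to one of them. -/
theorem KazhdanPropertyT.exists_invariant_near {G : Type*} [Group G] [TopologicalSpace G]
    [IsTopologicalGroup G] [LocallyCompactSpace G] [T2Space G] (hT : KazhdanPropertyT G)
    {V : Type*} [NormedAddCommGroup V] [InnerProductSpace ℂ V] [CompleteSpace V]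
    [TopologicalSpace.SeparableSpace V] (ρ : G →* (V ≃ₗᵢ[ℂ] V))
    (hρ : ∀ v, Continuous fun g => ρ g v) (v : ℕ → V)
    (hv : ∀ k, v k ≠ 0)
    (h : ∀ g, Tendsto (fun k => ‖ρ g (v k) - v k‖ / ‖v k‖) atTop (𝓝 0)) :
    ∃ k w, (∀ g, ρ g w = w) ∧ ‖w - v k‖ ≤ 1 / 2 * ‖v k‖ := by
  obtain ⟨ι, ⟨b⟩⟩ := exists_hilbertBasis_shrink V
  let e := b.repr
  let ρ' : G →* (lp (fun _ : ι => ℂ) 2 ≃ₗᵢ[ℂ] lp (fun _ : ι => ℂ) 2) :=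
    { toFun := fun g => (e.symm.trans (ρ g)).trans e
      map_one' := by ext1 x; simp
      map_mul' := fun g h => by ext1 x; simp }
  have hρ' : ∀ g x, ρ' g x = e (ρ g (e.symm x)) := fun _ _ => rfl
  obtain ⟨C, hC, hCε⟩ := hT _ ρ' fun x => e.continuous.comp (hρ (e.symm x))
  obtain ⟨δ, hδ, hδw⟩ := hCε (1 / 2) (by norm_num)
  have hpos : ∀ k, 0 < ‖v k‖ := fun k => norm_pos_iff.2 (hv k)
  have hev := eventually_forall_le_of_isCompact
    (d := fun k g => ‖ρ g (v k) - v k‖ / ‖v k‖)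
    (fun k => ((hρ _).sub continuous_const).norm.div_const _)
    (fun k g g' => by
      rw [← add_div]
      gcongr
      have e : ρ (g * g') (v k) - v k = ρ g (ρ g' (v k) - v k) + (ρ g (v k) - v k) := by
        rw [map_sub, unitaryRep_mul_apply]; abel
      rw [e, add_comm]
      refine (norm_add_le _ _).trans ?_
      rw [LinearIsometryEquiv.norm_map])
    (fun k g => by
      congr 1
      have e : ρ g⁻¹ (v k) - v k = ρ g⁻¹ (v k - ρ g (v k)) := by
        rw [map_sub, ← unitaryRep_mul_apply, inv_mul_cancel, map_one]; rfl
      rw [e, LinearIsometryEquiv.norm_map, norm_sub_rev])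
    h hC hδ
  obtain ⟨k, hk⟩ := hev.exists
  obtain ⟨w, hw, -, hwv⟩ := hδw (e (v k)) fun g hg => by
    rw [hρ', e.symm_apply_apply, ← map_sub, e.norm_map, e.norm_map]
    exact (div_le_iff₀ (hpos k)).1 (hk g hg)
  refine ⟨k, e.symm w, fun g => ?_, ?_⟩
  · have := hw g
    rw [hρ'] at this
    rw [← e.symm_apply_apply (ρ g (e.symm w)), this]
  · have e1 : e.symm w - v k = e.symm (w - e (v k)) := by simp
    rwa [e1, e.symm.norm_map, ← e.norm_map (v k)]

end Representations

/-! ### Half-densities and the Koopman representation -/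

section Koopman

open Filter Topology
open scoped ENNReal

theorem enorm_complex_ofReal (x : ℝ) : ‖(x : ℂ)‖ₑ = ‖x‖ₑ := by
  rw [← ofReal_norm, Complex.norm_real, ofReal_norm]

theorem secondCountableTopology_Lp_two {X : Type*} [MeasurableSpace X] (m : Measure X)
    [MeasurableSpace.CountablyGenerated X] [SFinite m] :
    SecondCountableTopology (Lp ℂ 2 m) :=
  have : Fact ((2 : ℝ≥0∞) ≠ ∞) := ⟨by norm_num⟩
  inferInstance

theorem Lp_two_enorm_sq {X : Type*} [MeasurableSpace X] {m : Measure X} (ξ : Lp ℂ 2 m) :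
    ‖ξ‖ₑ ^ 2 = ∫⁻ p, ‖ξ p‖ₑ ^ 2 ∂m := by
  have h := eLpNorm_nnreal_pow_eq_lintegral (f := ξ) (μ := m) (p := 2) (by norm_num)
  simpa [Lp.enorm_def] using h

/-- `J` is a positive Jacobian of the measurable map `T` of the measure space `(X, m)`: the change
of variables formula `∫ F(Tp) J(p) dm(p) = ∫ F dm` holds. -/
structure HasJacobian {X : Type*} [MeasurableSpace X] (m : Measure X) (T : X → X) (J : X → ℝ) :
    Prop where
  measurable : Measurable T
  measurable_jac : Measurable J
  pos : ∀ p, 0 < J p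
  lintegral_comp_mul : ∀ F : X → ℝ≥0∞, Measurable F →
    ∫⁻ p, F (T p) * ENNReal.ofReal (J p) ∂m = ∫⁻ p, F p ∂m

namespace HasJacobian

variable {X : Type*} [MeasurableSpace X] {m : Measure X} {T : X → X} {J : X → ℝ}

theorem quasiMeasurePreserving (h : HasJacobian m T J) : Measure.QuasiMeasurePreserving T m m := by
  refine ⟨h.measurable, Measure.AbsolutelyContinuous.mk fun s hs h0 => ?_⟩
  rw [Measure.map_apply h.measurable hs]
  have h1 := h.lintegral_comp_mul (s.indicator 1) (measurable_one.indicator hs)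
  rw [lintegral_indicator_one hs, h0, lintegral_eq_zero_iff] at h1
  · rw [measure_eq_zero_iff_ae_notMem]
    filter_upwards [h1] with p hp hps
    have : T p ∈ s := hps
    simp [Set.indicator_of_mem this, (h.pos p).not_ge] at hp
  · exact ((measurable_one.indicator hs).comp h.measurable).mul
      h.measurable_jac.ennreal_ofReal

theorem ofReal_eq_enorm_sqrt_sq (h : HasJacobian m T J) (p : X) :
    ‖((√(J p) : ℝ) : ℂ)‖ₑ ^ 2 = ENNReal.ofReal (J p) := by
  rw [enorm_complex_ofReal, Real.enorm_eq_ofReal (Real.sqrt_nonneg _),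
    ← ENNReal.ofReal_pow (Real.sqrt_nonneg _), Real.sq_sqrt (h.pos p).le]

theorem memLp_sqrt_mul_comp (h : HasJacobian m T J) (ξ : Lp ℂ 2 m) :
    MemLp (fun p => ((√(J p) : ℝ) : ℂ) * ξ (T p)) 2 m := by
  have hm : Measurable fun p => ((√(J p) : ℝ) : ℂ) * ξ (T p) :=
    (Complex.measurable_ofReal.comp h.measurable_jac.sqrt).mul
      ((Lp.stronglyMeasurable ξ).measurable.comp h.measurable)
  refine ⟨hm.aestronglyMeasurable, ?_⟩
  rw [eLpNorm_lt_top_iff_lintegral_rpow_enorm_lt_top (by norm_num) (by norm_num)]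
  have : ∫⁻ p, ‖((√(J p) : ℝ) : ℂ) * ξ (T p)‖ₑ ^ (2 : ℝ≥0∞).toReal ∂m = ‖ξ‖ₑ ^ 2 := by
    rw [Lp_two_enorm_sq, ← h.lintegral_comp_mul fun p => ‖ξ p‖ₑ ^ 2]
    · refine lintegral_congr fun p => ?_
      rw [ENNReal.toReal_ofNat, ENNReal.rpow_ofNat, enorm_mul, mul_pow, h.ofReal_eq_enorm_sqrt_sq,
        mul_comm]
    · exact (Lp.stronglyMeasurable ξ).measurable.enorm.pow_const 2
  rw [this]
  exact ENNReal.pow_lt_top enorm_lt_top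

/-- The isometry `ξ ↦ √J · (ξ ∘ T)` of `L²(m)`. -/
def koopman (h : HasJacobian m T J) : Lp ℂ 2 m →ₗᵢ[ℂ] Lp ℂ 2 m where
  toFun ξ := (h.memLp_sqrt_mul_comp ξ).toLp
  map_add' ξ η := by
    ext1
    filter_upwards [(h.memLp_sqrt_mul_comp (ξ + η)).coeFn_toLp,
      (h.memLp_sqrt_mul_comp ξ).coeFn_toLp, (h.memLp_sqrt_mul_comp η).coeFn_toLp,
      Lp.coeFn_add (h.memLp_sqrt_mul_comp ξ).toLp (h.memLp_sqrt_mul_comp η).toLp,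
      h.quasiMeasurePreserving.ae (Lp.coeFn_add ξ η)] with p h1 h2 h3 h4 h5
    rw [h1, h4, Pi.add_apply, h2, h3, h5, Pi.add_apply, mul_add]
  map_smul' c ξ := by
    ext1
    filter_upwards [(h.memLp_sqrt_mul_comp (c • ξ)).coeFn_toLp,
      (h.memLp_sqrt_mul_comp ξ).coeFn_toLp,
      Lp.coeFn_smul c (h.memLp_sqrt_mul_comp ξ).toLp,
      h.quasiMeasurePreserving.ae (Lp.coeFn_smul c ξ)] with p h1 h2 h4 h5
    rw [h1, RingHom.id_apply, h4, Pi.smul_apply, h2, h5, Pi.smul_apply, smul_eq_mul, smul_eq_mul]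
    ring
  norm_map' ξ := by
    have : ‖(h.memLp_sqrt_mul_comp ξ).toLp‖ₑ ^ 2 = ‖ξ‖ₑ ^ 2 := by
      rw [Lp_two_enorm_sq, Lp_two_enorm_sq, ← h.lintegral_comp_mul fun p => ‖ξ p‖ₑ ^ 2]
      · refine lintegral_congr_ae ?_
        filter_upwards [(h.memLp_sqrt_mul_comp ξ).coeFn_toLp] with p hp
        rw [hp, enorm_mul, mul_pow, h.ofReal_eq_enorm_sqrt_sq, mul_comm]
      · exact (Lp.stronglyMeasurable ξ).measurable.enorm.pow_const 2
    have h2 := congrArg ENNReal.toReal this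
    rw [ENNReal.toReal_pow, ENNReal.toReal_pow, toReal_enorm, toReal_enorm] at h2
    exact (sq_eq_sq₀ (norm_nonneg _) (norm_nonneg _)).1 h2

theorem coeFn_koopman (h : HasJacobian m T J) (ξ : Lp ℂ 2 m) :
    h.koopman ξ =ᵐ[m] fun p => ((√(J p) : ℝ) : ℂ) * ξ (T p) :=
  (h.memLp_sqrt_mul_comp ξ).coeFn_toLp

end HasJacobian

/-- A nonsingular measurable near-action of a group `G` on `(X, m)`: a jointly measurable family of
maps `T g` with positive Jacobians `J g`, for which the action law and the chain rule hold almost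
everywhere (for each pair of group elements). -/
structure NonsingularAction (G : Type*) [Group G] [MeasurableSpace G] {X : Type*}
    [MeasurableSpace X] (m : Measure X) where
  map : G → X → X
  jac : G → X → ℝ
  measurable_map : Measurable fun p : G × X => map p.1 p.2
  measurable_jac : Measurable fun p : G × X => jac p.1 p.2
  hasJacobian : ∀ g, HasJacobian m (map g) (jac g)
  map_one : ∀ᵐ p ∂m, map 1 p = p ∧ jac 1 p = 1
  map_mul : ∀ g h, ∀ᵐ p ∂m, map (g * h) p = map g (map h p) ∧
    jac (g * h) p = jac g (map h p) * jac h p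

namespace NonsingularAction

variable {G : Type*} [Group G] [MeasurableSpace G] {X : Type*} [MeasurableSpace X]
  {m : Measure X} (A : NonsingularAction G m)

theorem koopman_one (ξ : Lp ℂ 2 m) : (A.hasJacobian 1).koopman ξ = ξ := by
  ext1
  filter_upwards [(A.hasJacobian 1).coeFn_koopman ξ, A.map_one] with p h1 h2
  rw [h1, h2.1, h2.2]; simp

theorem koopman_mul (g h : G) (ξ : Lp ℂ 2 m) : (A.hasJacobian (g * h)).koopman ξ
    = (A.hasJacobian h).koopman ((A.hasJacobian g).koopman ξ) := by
  ext1
  filter_upwards [(A.hasJacobian (g * h)).coeFn_koopman ξ,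
    (A.hasJacobian h).coeFn_koopman ((A.hasJacobian g).koopman ξ),
    (A.hasJacobian h).quasiMeasurePreserving.ae ((A.hasJacobian g).coeFn_koopman ξ),
    A.map_mul g h] with p h1 h2 h3 h4
  rw [h1, h2, h3, h4.1, h4.2, Real.sqrt_mul ((A.hasJacobian g).pos _).le]
  push_cast
  ring

/-- The Koopman representation on half-densities, `g ↦ (ξ ↦ √J_{g⁻¹} · (ξ ∘ T_{g⁻¹}))`. -/
def koopmanRep : G →* (Lp ℂ 2 m ≃ₗᵢ[ℂ] Lp ℂ 2 m) where
  toFun g :=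
    { (A.hasJacobian g⁻¹).koopman with
      invFun := (A.hasJacobian g).koopman
      left_inv := fun ξ => by
        change (A.hasJacobian g).koopman ((A.hasJacobian g⁻¹).koopman ξ) = ξ
        rw [← A.koopman_mul]
        simpa using A.koopman_one ξ
      right_inv := fun ξ => by
        change (A.hasJacobian g⁻¹).koopman ((A.hasJacobian g).koopman ξ) = ξ
        rw [← A.koopman_mul]
        simpa using A.koopman_one ξ }
  map_one' := by
    ext1 ξ
    change (A.hasJacobian 1⁻¹).koopman ξ = ξ
    simpa using A.koopman_one ξ
  map_mul' g h := by
    ext1 ξ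
    change (A.hasJacobian (g * h)⁻¹).koopman ξ
      = (A.hasJacobian g⁻¹).koopman ((A.hasJacobian h⁻¹).koopman ξ)
    rw [← A.koopman_mul]
    simp only [mul_inv_rev]

theorem koopmanRep_inv_apply (g : G) (ξ : Lp ℂ 2 m) :
    A.koopmanRep g⁻¹ ξ = (A.hasJacobian g).koopman ξ := by
  change (A.hasJacobian g⁻¹⁻¹).koopman ξ = _
  simp only [inv_inv]

theorem enorm_koopman_sub_sq (g : G) (ξ η : Lp ℂ 2 m) :
    ‖(A.hasJacobian g).koopman ξ - η‖ₑ ^ 2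
      = ∫⁻ p, ‖((√(A.jac g p) : ℝ) : ℂ) * ξ (A.map g p) - η p‖ₑ ^ 2 ∂m := by
  rw [Lp_two_enorm_sq]
  refine lintegral_congr_ae ?_
  filter_upwards [Lp.coeFn_sub ((A.hasJacobian g).koopman ξ) η,
    (A.hasJacobian g).coeFn_koopman ξ] with p h1 h2
  rw [h1, Pi.sub_apply, h2]

theorem continuous_koopmanRep [TopologicalSpace G] [IsTopologicalGroup G] [LocallyCompactSpace G]
    [BorelSpace G] [MeasurableSpace.CountablyGenerated X] [SFinite m] (ξ : Lp ℂ 2 m) :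
    Continuous fun g => A.koopmanRep g ξ := by
  have := secondCountableTopology_Lp_two m
  refine continuous_orbit_of_measurable A.koopmanRep ξ fun η r => ?_
  have hm : Measurable fun g => ∫⁻ p, ‖((√(A.jac g p) : ℝ) : ℂ) * ξ (A.map g p) - η p‖ₑ ^ 2 ∂m := by
    refine Measurable.lintegral_prod_right' (f := fun q : G × X =>
      ‖((√(A.jac q.1 q.2) : ℝ) : ℂ) * ξ (A.map q.1 q.2) - η q.2‖ₑ ^ 2) ?_
    exact (((Complex.measurable_ofReal.comp A.measurable_jac.sqrt).mul
      ((Lp.stronglyMeasurable ξ).measurable.comp A.measurable_map)).sub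
      ((Lp.stronglyMeasurable η).measurable.comp measurable_snd)).enorm.pow_const 2
  have he : ∀ g, ‖A.koopmanRep g⁻¹ ξ - η‖ = √(∫⁻ p, ‖((√(A.jac g p) : ℝ) : ℂ) *
      ξ (A.map g p) - η p‖ₑ ^ 2 ∂m).toReal := fun g => by
    rw [koopmanRep_inv_apply, ← enorm_koopman_sub_sq, ENNReal.toReal_pow, toReal_enorm,
      Real.sqrt_sq (norm_nonneg _)]
  simp only [he]
  exact measurableSet_lt hm.ennreal_toReal.sqrt measurable_const

theorem invariant_density_of_invariant {w : Lp ℂ 2 m} (hw : ∀ g, A.koopmanRep g w = w) (g : G) :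
    ∀ᵐ p ∂m, ‖w (A.map g p)‖ₑ ^ 2 * ENNReal.ofReal (A.jac g p) = ‖w p‖ₑ ^ 2 := by
  have h := hw g⁻¹
  rw [koopmanRep_inv_apply] at h
  filter_upwards [(A.hasJacobian g).coeFn_koopman w] with p hp
  rw [h] at hp
  rw [hp, enorm_mul, mul_pow, (A.hasJacobian g).ofReal_eq_enorm_sqrt_sq, mul_comm]

/-- There is a finite invariant density whose zero set is minimal among those of all invariant
half-densities in `L²`. -/
theorem exists_maximal_invariant_density [MeasurableSpace.CountablyGenerated X] [SFinite m] :
    ∃ ψ : X → ℝ≥0∞, Measurable ψ ∧ ∫⁻ p, ψ p ∂m ≠ ∞ ∧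
      (∀ g, ∀ᵐ p ∂m, ψ (A.map g p) * ENNReal.ofReal (A.jac g p) = ψ p) ∧
      ∀ w : Lp ℂ 2 m, (∀ g, A.koopmanRep g w = w) → ∀ᵐ p ∂m, ψ p = 0 → w p = 0 := by
  have := secondCountableTopology_Lp_two m
  let S : Set (Lp ℂ 2 m) := {w | ∀ g, A.koopmanRep g w = w}
  have : Nonempty S := ⟨0, fun g => map_zero _⟩
  let w : ℕ → S := TopologicalSpace.denseSeq S
  let a : ℕ → ℝ≥0∞ := fun n => 2⁻¹ ^ (n + 1) / (‖(w n : Lp ℂ 2 m)‖ₑ ^ 2 + 1)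
  have hden : ∀ n, ‖(w n : Lp ℂ 2 m)‖ₑ ^ 2 + 1 ≠ ∞ := fun n =>
    ENNReal.add_ne_top.2 ⟨ENNReal.pow_ne_top enorm_ne_top, ENNReal.one_ne_top⟩
  have ha : ∀ n, a n ≠ 0 := fun n =>
    ENNReal.div_ne_zero.2 ⟨pow_ne_zero _ (by simp), hden n⟩
  have hmeas : ∀ n, Measurable fun p => ‖(w n : Lp ℂ 2 m) p‖ₑ ^ 2 := fun n =>
    (Lp.stronglyMeasurable _).measurable.enorm.pow_const 2
  refine ⟨fun p => ∑' n, a n * ‖(w n : Lp ℂ 2 m) p‖ₑ ^ 2,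
    Measurable.tsum fun n => (hmeas n).const_mul _, ?_, fun g => ?_, fun u hu => ?_⟩
  · rw [lintegral_tsum fun n => ((hmeas n).const_mul _).aemeasurable]
    refine ne_top_of_le_ne_top (b := ∑' n : ℕ, (2⁻¹ : ℝ≥0∞) ^ (n + 1)) ?_
      (ENNReal.tsum_le_tsum fun n => ?_)
    · rw [ENNReal.tsum_geometric_add_one]
      simp
    · rw [lintegral_const_mul _ (hmeas n), ← Lp_two_enorm_sq]
      calc a n * ‖(w n : Lp ℂ 2 m)‖ₑ ^ 2 ≤ a n * (‖(w n : Lp ℂ 2 m)‖ₑ ^ 2 + 1) := by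
            gcongr; exact le_self_add
        _ = _ := ENNReal.div_mul_cancel (by simp) (hden n)
  · filter_upwards [ae_all_iff.2 fun n => A.invariant_density_of_invariant (w n).2 g] with p hp
    rw [← ENNReal.tsum_mul_right]
    refine tsum_congr fun n => ?_
    rw [mul_assoc, hp n]
  · set Z : Set X := {p | ∑' n, a n * ‖(w n : Lp ℂ 2 m) p‖ₑ ^ 2 = 0} with hZ
    have hZm : MeasurableSet Z := measurableSet_eq_fun
      (Measurable.tsum fun n => (hmeas n).const_mul _) measurable_const
    have hwZ : ∀ n, ∀ p ∈ Z, (w n : Lp ℂ 2 m) p = 0 := fun n p hp => by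
      have := ENNReal.tsum_eq_zero.1 hp n
      simpa [ha n] using this
    have hle : ∀ n, ∫⁻ p in Z, ‖u p‖ₑ ^ 2 ∂m ≤ ‖u - w n‖ₑ ^ 2 := fun n => by
      rw [Lp_two_enorm_sq]
      refine le_trans (le_of_eq ?_) (setLIntegral_le_lintegral Z _)
      refine lintegral_congr_ae ?_
      filter_upwards [ae_restrict_mem hZm, ae_restrict_of_ae (Lp.coeFn_sub u (w n))] with p hp h1
      rw [h1, Pi.sub_apply, hwZ n p hp, sub_zero]
    have h0 : ∫⁻ p in Z, ‖u p‖ₑ ^ 2 ∂m = 0 := by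
      refine le_antisymm (ENNReal.le_of_forall_pos_le_add fun ε hε _ => ?_) zero_le
      obtain ⟨_, hx, ⟨n, rfl⟩⟩ := Metric.dense_iff.1
        (TopologicalSpace.denseRange_denseSeq S) ⟨u, hu⟩ (√ε) (by positivity)
      refine (hle n).trans ?_
      have hx' : ‖u - w n‖ < √ε := by
        rw [Metric.mem_ball, dist_comm, Subtype.dist_eq, dist_eq_norm] at hx
        exact hx
      have h2 : ‖u - w n‖ ^ 2 ≤ (ε : ℝ) := by
        have := Real.sq_sqrt (NNReal.coe_nonneg ε)
        nlinarith [norm_nonneg (u - w n)]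
      rw [zero_add, ← ofReal_norm, ← ENNReal.ofReal_pow (norm_nonneg _)]
      exact ENNReal.ofReal_le_of_le_toReal (by simpa using h2)
    rw [lintegral_eq_zero_iff ((Lp.stronglyMeasurable u).measurable.enorm.pow_const 2),
      Filter.EventuallyEq, ae_restrict_iff' hZm] at h0
    filter_upwards [h0] with p hp hpZ
    simpa using hp hpZ

/-- For a group with property (T), the zero set of a maximal finite invariant density carries no
sequence of densities that is almost invariant in `L¹` under each group element.  The square roots
of such densities would be almost invariant in `L²`, hence close to an invariant vector. -/
theorem exists_invariant_density_of_kazhdan [TopologicalSpace G] [IsTopologicalGroup G]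
    [LocallyCompactSpace G] [T2Space G] [BorelSpace G] (hT : KazhdanPropertyT G)
    [MeasurableSpace.CountablyGenerated X] [SFinite m] :
    ∃ ψ : X → ℝ≥0∞, Measurable ψ ∧ ∫⁻ p, ψ p ∂m ≠ ∞ ∧
      (∀ g, ∀ᵐ p ∂m, ψ (A.map g p) * ENNReal.ofReal (A.jac g p) = ψ p) ∧
      ∀ (q : ℕ → X → ℝ) (c : ℝ≥0∞), (∀ k, Measurable (q k)) → (∀ k p, 0 ≤ q k p) →
        (∀ k p, ψ p ≠ 0 → q k p = 0) → c ≠ 0 → (∀ k, c ≤ ∫⁻ p, ‖q k p‖ₑ ∂m) →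
        (∀ k, ∫⁻ p, ‖q k p‖ₑ ∂m ≠ ∞) →
        ¬ ∀ g, Tendsto (fun k => ∫⁻ p, ‖q k (A.map g p) * A.jac g p - q k p‖ₑ ∂m) atTop (𝓝 0) := by
  obtain ⟨ψ, hψm, hψi, hψinv, hψ⟩ := A.exists_maximal_invariant_density
  refine ⟨ψ, hψm, hψi, hψinv, fun q c hqm hq0 hqψ hc hcq hqi hlim => ?_⟩
  have hsq : ∀ k p, ‖((√(q k p) : ℝ) : ℂ)‖ₑ ^ 2 = ‖q k p‖ₑ := fun k p => by
    rw [enorm_complex_ofReal, Real.enorm_eq_ofReal (Real.sqrt_nonneg _),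
      ← ENNReal.ofReal_pow (Real.sqrt_nonneg _), Real.sq_sqrt (hq0 k p),
      Real.enorm_eq_ofReal (hq0 k p)]
  have hmem : ∀ k, MemLp (fun p => ((√(q k p) : ℝ) : ℂ)) 2 m := fun k => by
    refine ⟨(Complex.measurable_ofReal.comp (hqm k).sqrt).aestronglyMeasurable, ?_⟩
    rw [eLpNorm_lt_top_iff_lintegral_rpow_enorm_lt_top (by norm_num) (by norm_num)]
    simp only [ENNReal.toReal_ofNat, ENNReal.rpow_ofNat, hsq]
    exact (hqi k).lt_top
  let v : ℕ → Lp ℂ 2 m := fun k => (hmem k).toLp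
  have hvn : ∀ k, ‖v k‖ₑ ^ 2 = ∫⁻ p, ‖q k p‖ₑ ∂m := fun k => by
    rw [Lp_two_enorm_sq]
    refine lintegral_congr_ae ?_
    filter_upwards [(hmem k).coeFn_toLp] with p hp
    rw [hp, hsq]
  have hv0 : ∀ k, v k ≠ 0 := fun k hk => by
    have h1 := hvn k
    rw [hk] at h1
    have h2 := hcq k
    rw [← h1] at h2
    simp [hc] at h2
  have hdiff : ∀ g k, ‖A.koopmanRep g⁻¹ (v k) - v k‖ₑ ^ 2
      ≤ ∫⁻ p, ‖q k (A.map g p) * A.jac g p - q k p‖ₑ ∂m := fun g k => by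
    rw [koopmanRep_inv_apply, enorm_koopman_sub_sq]
    refine lintegral_mono_ae ?_
    filter_upwards [(hmem k).coeFn_toLp,
      (A.hasJacobian g).quasiMeasurePreserving.ae (hmem k).coeFn_toLp] with p h1 h2
    rw [h1, h2, ← Complex.ofReal_mul, ← Complex.ofReal_sub, enorm_complex_ofReal, mul_comm (√_),
      ← Real.sqrt_mul (hq0 _ _)]
    have hx : 0 ≤ q k (A.map g p) * A.jac g p :=
      mul_nonneg (hq0 _ _) ((A.hasJacobian g).pos p).le
    generalize q k (A.map g p) * A.jac g p = x at hx
    have hy := hq0 k p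
    generalize q k p = y at hy
    rw [← ofReal_norm, ← ofReal_norm, ← ENNReal.ofReal_pow (norm_nonneg _)]
    refine ENNReal.ofReal_le_ofReal ?_
    rw [Real.norm_eq_abs, Real.norm_eq_abs]
    -- `|√x - √y|² ≤ |√x - √y| (√x + √y) = |x - y|`
    have e : x - y = (√x - √y) * (√x + √y) := by
      ring_nf; rw [Real.sq_sqrt hx, Real.sq_sqrt hy]
    have h3 : |√x - √y| ≤ √x + √y := by
      rw [abs_le]; constructor <;> linarith [Real.sqrt_nonneg x, Real.sqrt_nonneg y]
    rw [e, abs_mul, abs_of_nonneg (add_nonneg (Real.sqrt_nonneg x) (Real.sqrt_nonneg y)), sq]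
    gcongr
  have hlim' : ∀ g, Tendsto (fun k => ‖A.koopmanRep g (v k) - v k‖ / ‖v k‖) atTop (𝓝 0) := by
    intro g
    have hD := hlim g⁻¹
    have hc' : c ≠ ∞ := ne_top_of_le_ne_top (hqi 0) (hcq 0)
    have h1 : Tendsto (fun k => √((∫⁻ p, ‖q k (A.map g⁻¹ p) * A.jac g⁻¹ p - q k p‖ₑ ∂m).toReal
        / c.toReal)) atTop (𝓝 0) := by
      have := (((ENNReal.tendsto_toReal ENNReal.zero_ne_top).comp hD).div_const c.toReal).sqrt
      simpa using this
    refine tendsto_of_tendsto_of_tendsto_of_le_of_le' tendsto_const_nhds h1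
      (Eventually.of_forall fun k => by positivity) ?_
    filter_upwards [hD.eventually (gt_mem_nhds ENNReal.zero_lt_top)] with k hk
    refine Real.le_sqrt_of_sq_le ?_
    rw [div_pow]
    have hcpos : 0 < c.toReal := ENNReal.toReal_pos hc hc'
    refine div_le_div₀ ENNReal.toReal_nonneg ?_ hcpos ?_
    · rw [← toReal_enorm, ← ENNReal.toReal_pow]
      refine ENNReal.toReal_mono hk.ne ?_
      simpa using hdiff g⁻¹ k
    · rw [← toReal_enorm (v k), ← ENNReal.toReal_pow, hvn]
      exact ENNReal.toReal_mono (hqi k) (hcq k)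
  have := secondCountableTopology_Lp_two m
  obtain ⟨k, w, hw, hwv⟩ :=
    hT.exists_invariant_near A.koopmanRep A.continuous_koopmanRep v hv0 hlim'
  have hZm : MeasurableSet {p | ψ p = 0} := measurableSet_eq_fun hψm measurable_const
  have hge : ‖v k‖ₑ ^ 2 ≤ ‖w - v k‖ₑ ^ 2 := by
    rw [Lp_two_enorm_sq, Lp_two_enorm_sq]
    refine lintegral_mono_ae ?_
    filter_upwards [hψ w hw, (hmem k).coeFn_toLp, Lp.coeFn_sub w (v k)] with p h1 h2 h3
    by_cases hp : ψ p = 0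
    · rw [h3, Pi.sub_apply, h1 hp, zero_sub, enorm_neg]
    · rw [h2, hqψ k p hp]; simp
  have hge' : ‖v k‖ ≤ ‖w - v k‖ := by
    have := ENNReal.toReal_mono (ENNReal.pow_ne_top enorm_ne_top) hge
    rw [ENNReal.toReal_pow, ENNReal.toReal_pow, toReal_enorm, toReal_enorm] at this
    exact le_of_sq_le_sq this (norm_nonneg _)
  linarith [norm_pos_iff.2 (hv0 k)]

end NonsingularAction

end Koopman

/-! ### Distribution functions of measures on the line -/

section DistributionFunction

open Filter Topology Set
open scoped ENNReal

variable (κ : Measure ℝ) [IsFiniteMeasure κ]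

theorem monotone_measureReal_Iic : Monotone fun x => κ.real (Iic x) := fun _ _ h =>
  measureReal_mono (Iic_subset_Iic.2 h)

variable [NullSingletonClass κ]

theorem continuous_measureReal_Iic : Continuous fun x => κ.real (Iic x) := by
  have e : (fun x => κ.real (Iic x)) = fun x => ∫ t, (Iic x).indicator 1 t ∂κ := by
    funext x
    exact (integral_indicator_one measurableSet_Iic).symm
  rw [e]
  refine continuous_iff_continuousAt.2 fun x₀ => ?_
  refine continuousAt_of_dominated (bound := fun _ => 1)
    (Eventually.of_forall fun x =>
      (measurable_one.indicator measurableSet_Iic).aestronglyMeasurable)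
    (Eventually.of_forall fun x => Eventually.of_forall fun t => ?_) (integrable_const _) ?_
  · by_cases ht : t ∈ Iic x <;> simp [ht]
  · have h0 : ∀ᵐ t ∂κ, t ≠ x₀ := by
      rw [ae_iff]; simp
    filter_upwards [h0] with t ht
    rcases ht.lt_or_gt with h | h
    · have : (fun x => (Iic x).indicator (1 : ℝ → ℝ) t) =ᶠ[𝓝 x₀] fun _ => 1 := by
        filter_upwards [lt_mem_nhds h] with x hx
        simp [hx.le]
      exact continuousAt_const.congr this.symm
    · have : (fun x => (Iic x).indicator (1 : ℝ → ℝ) t) =ᶠ[𝓝 x₀] fun _ => 0 := by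
        filter_upwards [gt_mem_nhds h] with x hx
        simp [hx]
      exact continuousAt_const.congr this.symm

/-- A finite measure on the line without atoms is pushed forward to Lebesgue measure by its
distribution function. -/
theorem map_measureReal_Iic :
    κ.map (fun x => κ.real (Iic x)) = volume.restrict (Ioc 0 (κ.real univ)) := by
  set Φ : ℝ → ℝ := fun x => κ.real (Iic x) with hΦ
  have hc : Continuous Φ := continuous_measureReal_Iic κ
  have hmono : Monotone Φ := monotone_measureReal_Iic κ
  have hbot : Tendsto Φ atBot (𝓝 0) := by
    have h := tendsto_measure_iInter_atBot (μ := κ) (s := fun x : ℝ => Iic x)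
      (fun _ => measurableSet_Iic.nullMeasurableSet) (fun _ _ h => Iic_subset_Iic.2 h)
      ⟨0, measure_ne_top _ _⟩
    have h' := (ENNReal.tendsto_toReal (measure_ne_top _ _)).comp h
    simpa [iInter_Iic_eq_empty_iff.2, Function.comp_def, hΦ, Measure.real] using h'
  have htop : Tendsto Φ atTop (𝓝 (κ.real univ)) :=
    (ENNReal.tendsto_toReal (measure_ne_top _ _)).comp (tendsto_measure_Iic_atTop κ)
  refine Measure.ext_of_Iic _ _ fun y => ?_
  rw [Measure.map_apply hc.measurable measurableSet_Iic, Measure.restrict_apply measurableSet_Iic,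
    inter_comm, ← Ioi_inter_Iic, inter_assoc, Iic_inter_Iic, Ioi_inter_Iic, Real.volume_Ioc,
    sub_zero]
  rcases le_or_gt (κ.real univ) y with hy | hy
  · have : Φ ⁻¹' Iic y = univ := eq_univ_of_forall fun x =>
      (measureReal_mono (subset_univ _)).trans hy
    rw [this, min_eq_left hy, ofReal_measureReal]
  rw [min_eq_right hy.le]
  rcases (Φ ⁻¹' Iic y).eq_empty_or_nonempty with hS | hS
  · rw [hS, measure_empty, ENNReal.ofReal_of_nonpos]
    by_contra! h
    obtain ⟨x, hx⟩ := (hbot.eventually (gt_mem_nhds h)).exists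
    exact (hS ▸ (show x ∈ Φ ⁻¹' Iic y from hx.le) : x ∈ (∅ : Set ℝ))
  · have hbdd : BddAbove (Φ ⁻¹' Iic y) := by
      obtain ⟨b, hb⟩ := (htop.eventually (lt_mem_nhds hy)).exists
      exact ⟨b, fun x hx => (hmono.reflect_lt ((mem_Iic.1 hx).trans_lt hb)).le⟩
    set a := sSup (Φ ⁻¹' Iic y) with ha
    have haS : Φ a ≤ y := (isClosed_Iic.preimage hc).csSup_mem hS hbdd
    have hya : y ≤ Φ a := by
      by_contra! h
      obtain ⟨b, hb, hab⟩ :=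
        (((hc.tendsto a).eventually (gt_mem_nhds h)).filter_mono
          nhdsWithin_le_nhds |>.and (self_mem_nhdsWithin (s := Ioi a))).exists
      exact (not_le.2 hab) (le_csSup hbdd hb.le)
    have hSa : Φ ⁻¹' Iic y = Iic a :=
      Subset.antisymm (fun x hx => le_csSup hbdd hx) fun x hx => (hmono hx).trans haS
    rw [hSa, ← le_antisymm haS hya, hΦ, ofReal_measureReal]

theorem ae_measureReal_Iic_pos : ∀ᵐ x ∂κ, 0 < κ.real (Iic x) := by
  have h : ∀ᵐ y ∂(κ.map fun x => κ.real (Iic x)), 0 < y := by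
    rw [map_measureReal_Iic]
    filter_upwards [ae_restrict_mem measurableSet_Ioc] with y hy using hy.1
  exact ae_of_ae_map (continuous_measureReal_Iic κ).aemeasurable h

theorem lintegral_rpow_measureReal_Iic {s : ℝ} (hs : 0 < s) :
    ∫⁻ x, ENNReal.ofReal (s * κ.real (Iic x) ^ (s - 1)) ∂κ = ENNReal.ofReal (κ.real univ ^ s) := by
  have hm : Measurable fun y : ℝ => ENNReal.ofReal (s * y ^ (s - 1)) := by fun_prop
  rw [← lintegral_map (f := fun y : ℝ => ENNReal.ofReal (s * y ^ (s - 1))) hm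
    (continuous_measureReal_Iic κ).measurable, map_measureReal_Iic]
  have hH : 0 ≤ κ.real univ := measureReal_nonneg
  have hi : IntervalIntegrable (fun y : ℝ => s * y ^ (s - 1)) volume 0 (κ.real univ) :=
    (intervalIntegral.intervalIntegrable_rpow' (by linarith)).const_mul s
  rw [← ofReal_integral_eq_lintegral_ofReal
    ((intervalIntegrable_iff_integrableOn_Ioc_of_le hH).1 hi)
    ((ae_restrict_mem measurableSet_Ioc).mono fun y hy =>
      mul_nonneg hs.le (Real.rpow_nonneg hy.1.le _)),
    ← intervalIntegral.integral_of_le hH, intervalIntegral.integral_const_mul,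
    integral_rpow (Or.inl (by linarith))]
  congr 1
  rw [sub_add_cancel, Real.zero_rpow hs.ne', sub_zero]
  field_simp

variable {κ}

/-- Weighting the distribution function `h` of `κ` by a continuous positive density `D` multiplies
it by a factor which at the left end of the support tends to the value of `D`.  So for small `s`
the densities `h ^ (s - 1)`, which concentrate there, are almost invariant under a change of
variables with derivative `D`.  The factor `s = 1 / (k + 1)` normalises their mass. -/
theorem tendsto_lintegral_rpow_sub (h01 : ∀ᵐ x ∂κ, x ∈ Icc (0 : ℝ) 1) (hκ : κ.real univ ≤ 1)
    {D : ℝ → ℝ} (hD : Continuous D) (hpos : ∀ x, 0 < D x) :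
    Tendsto (fun k : ℕ => ∫⁻ x, ‖(k + 1 : ℝ)⁻¹ * (∫ t in Iic x, D t ∂κ) ^ ((k + 1 : ℝ)⁻¹ - 1) * D x
      - (k + 1 : ℝ)⁻¹ * κ.real (Iic x) ^ ((k + 1 : ℝ)⁻¹ - 1)‖ₑ ∂κ) atTop (𝓝 0) := by
  rcases eq_or_ne κ 0 with rfl | hκ0
  · simp
  have hHpos : 0 < κ.real univ := by
    simpa [Measure.real, ENNReal.toReal_pos_iff, pos_iff_ne_zero] using hκ0
  set h : ℝ → ℝ := fun x => κ.real (Iic x) with hh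
  have hc : Continuous h := continuous_measureReal_Iic κ
  have hmono : Monotone h := monotone_measureReal_Iic κ
  have hle1 : ∀ x, h x ≤ 1 := fun x => (measureReal_mono (subset_univ _)).trans hκ
  -- two-sided bounds of `D` on the unit interval
  obtain ⟨a, -, ha⟩ := isCompact_Icc.exists_isMinOn (nonempty_Icc.2 zero_le_one) hD.continuousOn
    (s := Icc (0 : ℝ) 1)
  obtain ⟨b, -, hb⟩ := isCompact_Icc.exists_isMaxOn (nonempty_Icc.2 zero_le_one) hD.continuousOn
    (s := Icc (0 : ℝ) 1)
  set c := D a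
  set C := D b
  have hcpos : 0 < c := hpos a
  have hCpos : 0 < C := hpos b
  have hDc : ∀ᵐ x ∂κ, c ≤ D x := h01.mono fun x hx => ha hx
  have hDC : ∀ᵐ x ∂κ, D x ≤ C := h01.mono fun x hx => hb hx
  have hDi : Integrable D κ := by
    refine Integrable.of_bound (C := C) hD.aestronglyMeasurable ?_
    filter_upwards [hDC] with x hx
    rwa [Real.norm_of_nonneg (hpos x).le]
  set h' : ℝ → ℝ := fun x => ∫ t in Iic x, D t ∂κ with hh'
  have hlow : ∀ x, c * h x ≤ h' x := fun x => by
    have := setIntegral_mono_ae (s := Iic x) (μ := κ) (f := fun _ => c)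
      (integrable_const c).integrableOn hDi.integrableOn hDc
    simpa [hh, mul_comm] using this
  have hupp : ∀ x, h' x ≤ C * h x := fun x => by
    have := setIntegral_mono_ae (s := Iic x) (μ := κ) (g := fun _ => C) hDi.integrableOn
      (integrable_const C).integrableOn hDC
    simpa [hh, mul_comm] using this
  -- the left end of the support
  have hSne : ∃ x, h x ≤ 0 := by
    refine ⟨-1, ((measureReal_eq_zero_iff (measure_ne_top _ _)).2 ?_).le⟩
    rw [measure_eq_zero_iff_ae_notMem]
    filter_upwards [h01] with x hx hx1
    linarith [hx.1, mem_Iic.1 hx1]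
  have hh1 : h 1 = κ.real univ := by
    refine measureReal_congr ?_
    filter_upwards [h01] with x hx
    exact propext ⟨fun _ => trivial, fun _ => hx.2⟩
  have hSbdd : BddAbove {x | h x ≤ 0} :=
    ⟨1, fun x hx => (hmono.reflect_lt (lt_of_le_of_lt hx (hh1 ▸ hHpos))).le⟩
  set x₀ := sSup {x | h x ≤ 0}
  have hgt : ∀ x, x₀ < x → 0 < h x := fun x hx => by
    by_contra! hx'
    exact hx.not_ge (le_csSup hSbdd hx')
  have hx₀ : h x₀ ≤ 0 := (isClosed_le hc continuous_const).csSup_mem hSne hSbdd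
  have hae : ∀ᵐ x ∂κ, x₀ < x := by
    filter_upwards [ae_measureReal_Iic_pos κ] with x hx
    exact hmono.reflect_lt (hx₀.trans_lt hx)
  rw [ENNReal.tendsto_nhds_zero]
  intro ε hε
  obtain ⟨ε', hε', hεε⟩ : ∃ ε' : ℝ, 0 < ε' ∧ ENNReal.ofReal ε' ≤ ε := by
    rcases eq_or_ne ε ∞ with rfl | hε1
    · exact ⟨1, one_pos, le_top⟩
    · exact ⟨ε.toReal, ENNReal.toReal_pos hε.ne' hε1, ENNReal.ofReal_toReal_le⟩
  obtain ⟨θ, hθ, hθε⟩ : ∃ θ > 0, 4 * θ / c = ε' / 3 :=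
    ⟨c * ε' / 12, by positivity, by field_simp; norm_num⟩
  obtain ⟨δ, hδ, hDδ⟩ := Metric.continuousAt_iff.1 (hD.continuousAt (x := x₀)) θ hθ
  set η := h (x₀ + δ / 2)
  have hη : 0 < η := hgt _ (by linarith)
  -- the small parameters, as functions of `s`
  let e : ℝ → ℝ := fun s => |c ^ s - 1| + |C ^ s - 1|
  have he0 : Tendsto (fun k : ℕ => e (k + 1 : ℝ)⁻¹) atTop (𝓝 0) := by
    have hs : Tendsto (fun k : ℕ => (k + 1 : ℝ)⁻¹) atTop (𝓝 0) := by
      simpa using tendsto_one_div_add_atTop_nhds_zero_nat (𝕜 := ℝ)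
    have hce : Continuous e := by
      have h1 : Continuous fun s : ℝ => c ^ s := Real.continuous_const_rpow hcpos.ne'
      have h2 : Continuous fun s : ℝ => C ^ s := Real.continuous_const_rpow hCpos.ne'
      fun_prop
    have := (hce.tendsto 0).comp hs
    simpa [e, Function.comp_def] using this
  set K := 2 * (C / c + 1) + 1
  have hK : 0 < K := by positivity
  have hs0 : Tendsto (fun k : ℕ => (k + 1 : ℝ)⁻¹ * (K / η)) atTop (𝓝 0) := by
    have hs : Tendsto (fun k : ℕ => (k + 1 : ℝ)⁻¹) atTop (𝓝 0) := by
      simpa using tendsto_one_div_add_atTop_nhds_zero_nat (𝕜 := ℝ)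
    simpa using hs.mul_const (K / η)
  filter_upwards [he0.eventually (gt_mem_nhds (show 0 < min 1 (ε' / 3) by positivity)),
    hs0.eventually (gt_mem_nhds (show 0 < ε' / 3 by positivity))] with k hk1 hk2
  set s : ℝ := (k + 1 : ℝ)⁻¹
  have hs : 0 < s := by positivity
  have hs1 : s ≤ 1 := inv_le_one_of_one_le₀ (by linarith [k.cast_nonneg (α := ℝ)])
  have hes : 0 ≤ e s := by positivity
  have hpt : ∀ᵐ x ∂κ, ‖s * h' x ^ (s - 1) * D x - s * h x ^ (s - 1)‖ₑ
      ≤ ENNReal.ofReal (s * h x ^ (s - 1)) * ENNReal.ofReal (4 * θ / c + e s)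
        + ENNReal.ofReal (s * (K / η)) := by
    filter_upwards [hae, hDc, hDC] with x hx hxc hxC
    have hhx : 0 < h x := hgt x hx
    set r := h' x / h x with hr
    have hrc : c ≤ r := (le_div_iff₀ hhx).2 (hlow x)
    have hrC : r ≤ C := (div_le_iff₀ hhx).2 (hupp x)
    have hr0 : 0 < r := hcpos.trans_le hrc
    have hh'x : h' x = h x * r := by rw [hr]; field_simp
    have hA : 0 ≤ s * h x ^ (s - 1) := by positivity
    rw [← ENNReal.ofReal_mul hA, ← ENNReal.ofReal_add (by positivity) (by positivity),
      Real.enorm_eq_ofReal_abs]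
    refine ENNReal.ofReal_le_ofReal ?_
    have e1 : s * h' x ^ (s - 1) * D x - s * h x ^ (s - 1)
        = s * h x ^ (s - 1) * ((D x / r - 1) * r ^ s + (r ^ s - 1)) := by
      rw [hh'x, Real.mul_rpow hhx.le hr0.le, Real.rpow_sub_one hr0.ne']
      field_simp
      ring
    have hrs : |r ^ s - 1| ≤ e s := by
      have h1 : c ^ s ≤ r ^ s := Real.rpow_le_rpow hcpos.le hrc hs.le
      have h2 : r ^ s ≤ C ^ s := Real.rpow_le_rpow hr0.le hrC hs.le
      rw [abs_le]
      constructor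
      · linarith [neg_abs_le (c ^ s - 1), abs_nonneg (C ^ s - 1)]
      · linarith [le_abs_self (C ^ s - 1), abs_nonneg (c ^ s - 1)]
    have he1 : e s ≤ 1 := (hk1.le).trans (min_le_left _ _)
    have hrs2 : r ^ s ≤ 2 := by linarith [le_abs_self (r ^ s - 1)]
    have hrs0 : 0 ≤ r ^ s := by positivity
    have e2 : |(D x / r - 1) * r ^ s + (r ^ s - 1)| ≤ |D x / r - 1| * 2 + e s := by
      refine (abs_add_le _ _).trans (add_le_add ?_ hrs)
      rw [abs_mul, abs_of_nonneg hrs0]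
      gcongr
    rw [e1, abs_mul, abs_of_nonneg hA]
    rcases lt_or_ge (h x) η with hxη | hxη
    · have hxδ : x < x₀ + δ / 2 := hmono.reflect_lt hxη
      have hnear : ∀ t, x₀ < t → t ≤ x → |D t - D x₀| ≤ θ := fun t ht htx => by
        have := hDδ (x := t) (by rw [Real.dist_eq, abs_lt]; constructor <;> linarith)
        rw [Real.dist_eq] at this
        exact this.le
      have hrD : |r - D x₀| ≤ θ := by
        have h1 : ‖∫ t in Iic x, (D t - D x₀) ∂κ‖ ≤ θ * κ.real (Iic x) := by
          refine norm_setIntegral_le_of_norm_le_const_ae (measure_lt_top _ _) ?_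
          rw [ae_restrict_iff' measurableSet_Iic]
          filter_upwards [hae] with t ht htx using hnear t ht htx
        rw [integral_sub hDi.integrableOn (integrable_const _).integrableOn] at h1
        have h2 : r - D x₀ = (∫ t in Iic x, D t ∂κ - ∫ t in Iic x, D x₀ ∂κ) / h x := by
          rw [hr, eq_div_iff hhx.ne', sub_mul, div_mul_cancel₀ _ hhx.ne']
          simp [hh, hh', mul_comm]
        rw [h2, abs_div, abs_of_pos hhx, div_le_iff₀ hhx]
        exact h1
      have hDr : |D x / r - 1| ≤ 2 * θ / c := by
        have e3 : D x / r - 1 = (D x - r) / r := by field_simp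
        rw [e3, abs_div, abs_of_pos hr0]
        refine div_le_div₀ (by positivity) ?_ hcpos hrc
        have := hnear x hx le_rfl
        rw [abs_le] at this hrD ⊢
        constructor <;> linarith [this.1, this.2, hrD.1, hrD.2]
      have h5 : |(D x / r - 1) * r ^ s + (r ^ s - 1)| ≤ 4 * θ / c + e s := by
        refine e2.trans ?_
        have : 4 * θ / c = 2 * θ / c * 2 := by ring
        rw [this]
        gcongr
      have h6 : 0 ≤ s * (K / η) := by positivity
      linarith [mul_le_mul_of_nonneg_left h5 hA]
    · have hDr : |D x / r - 1| ≤ C / c + 1 := by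
        have h1 : D x / r ≤ C / c := div_le_div₀ hCpos.le hxC hcpos hrc
        have h2 : 0 < D x / r := div_pos (hpos x) hr0
        rw [abs_le]
        constructor <;> linarith
      have h5 : |(D x / r - 1) * r ^ s + (r ^ s - 1)| ≤ K := by
        refine e2.trans ?_
        have : K = (C / c + 1) * 2 + 1 := by ring
        rw [this]
        gcongr
      have h7 : h x ^ (s - 1) ≤ 1 / η := by
        have e4 : h x ^ (s - 1) = h x ^ s / h x := Real.rpow_sub_one hhx.ne' s
        rw [e4]
        exact div_le_div₀ zero_le_one (Real.rpow_le_one hhx.le (hle1 x) hs.le) hη hxη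
      have h8 : s * h x ^ (s - 1) * |(D x / r - 1) * r ^ s + (r ^ s - 1)| ≤ s * (K / η) := by
        calc _ ≤ s * (1 / η) * K := by gcongr
          _ = _ := by ring
      have h9 : 0 ≤ s * h x ^ (s - 1) * (4 * θ / c + e s) := by positivity
      linarith
  refine (lintegral_mono_ae hpt).trans (le_trans ?_ hεε)
  have hm : Measurable fun x => ENNReal.ofReal (s * h x ^ (s - 1)) := by
    have := hc.measurable
    fun_prop
  rw [lintegral_add_right _ measurable_const, lintegral_mul_const _ hm,
    lintegral_rpow_measureReal_Iic κ hs, lintegral_const]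
  have hu : κ univ ≤ 1 := by
    rw [← ofReal_measureReal (μ := κ) (s := univ)]
    exact ENNReal.ofReal_le_one.2 hκ
  calc _ ≤ 1 * ENNReal.ofReal (4 * θ / c + e s) + ENNReal.ofReal (s * (K / η)) * 1 := by
        gcongr
        exact ENNReal.ofReal_le_one.2 (Real.rpow_le_one hHpos.le hκ hs.le)
    _ = ENNReal.ofReal (4 * θ / c + e s + s * (K / η)) := by
        rw [one_mul, mul_one, ← ENNReal.ofReal_add (by positivity) (by positivity)]
    _ ≤ _ := by
        refine ENNReal.ofReal_le_ofReal ?_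
        linarith [min_le_right 1 (ε' / 3)]

end DistributionFunction

/-! ### Cocycles of interval diffeomorphisms -/

section IntervalCocycles

open Filter Topology Set
open scoped ENNReal

section FibreMeasure

variable {M : Type*}

/-- Lebesgue measure on the fibre over `m` of the subset `B` of `M × (0, 1]`. -/
def fibreMeasure (B : Set (M × ℝ)) (m : M) : Measure ℝ :=
  (volume.restrict (Ioc 0 1)).restrict (Prod.mk m ⁻¹' B)

instance (B : Set (M × ℝ)) (m : M) : IsFiniteMeasure (fibreMeasure B m) := by
  unfold fibreMeasure; infer_instance

instance (B : Set (M × ℝ)) (m : M) : NullSingletonClass (fibreMeasure B m) := by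
  unfold fibreMeasure; infer_instance

theorem fibreMeasure_real_univ_le (B : Set (M × ℝ)) (m : M) : (fibreMeasure B m).real univ ≤ 1 := by
  have h : fibreMeasure B m univ ≤ 1 := by
    refine (Measure.restrict_apply_le _ _).trans ?_
    simp
  exact ENNReal.toReal_le_of_le_ofReal zero_le_one (by simpa using h)

/-- The densities `s h ^ (s - 1)` along the fibres of `B`, where `h` is the distribution function of
Lebesgue measure on the fibre and `s = 1 / (k + 1)`.  As `k` grows they concentrate at the left end
of the fibre. -/
def edgeDensity (B : Set (M × ℝ)) (k : ℕ) : M × ℝ → ℝ :=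
  B.indicator fun p => (k + 1 : ℝ)⁻¹ * (fibreMeasure B p.1).real (Iic p.2) ^ ((k + 1 : ℝ)⁻¹ - 1)

theorem edgeDensity_nonneg (B : Set (M × ℝ)) (k : ℕ) (p : M × ℝ) : 0 ≤ edgeDensity B k p :=
  indicator_nonneg (fun _ _ => by positivity) p

variable [MeasurableSpace M]

theorem lintegral_fibreMeasure {B : Set (M × ℝ)} (hB : MeasurableSet B) (m : M) (F : ℝ → ℝ≥0∞) :
    ∫⁻ x, F x ∂fibreMeasure B m
      = ∫⁻ x in Ioc 0 1, B.indicator (fun p => F p.2) (m, x) := by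
  rw [fibreMeasure, ← lintegral_indicator (measurable_prodMk_left hB)]
  rfl

theorem measurable_fibreMeasure_Iic {B : Set (M × ℝ)} (hB : MeasurableSet B) :
    Measurable fun p : M × ℝ => (fibreMeasure B p.1).real (Iic p.2) := by
  have e : ∀ p : M × ℝ, fibreMeasure B p.1 (Iic p.2)
      = ∫⁻ t in Ioc 0 1, {q : (M × ℝ) × ℝ | (q.1.1, q.2) ∈ B ∧ q.2 ≤ q.1.2}.indicator 1 (p, t) := by
    intro p
    rw [← lintegral_indicator_one measurableSet_Iic, lintegral_fibreMeasure hB]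
    refine lintegral_congr fun t => ?_
    by_cases h1 : (p.1, t) ∈ B <;> by_cases h2 : t ≤ p.2 <;> simp [indicator, h1, h2]
  have hm : MeasurableSet {q : (M × ℝ) × ℝ | (q.1.1, q.2) ∈ B ∧ q.2 ≤ q.1.2} :=
    ((measurable_fst.fst.prodMk measurable_snd) hB).inter
      (measurableSet_le measurable_snd measurable_fst.snd)
  refine Measurable.ennreal_toReal ?_
  simp only [e]
  exact (measurable_one.indicator hm).lintegral_prod_right'

theorem lintegral_fibreMeasure_univ {B : Set (M × ℝ)} (hB : MeasurableSet B)
    (μ : Measure M) [SFinite μ] :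
    ∫⁻ m, fibreMeasure B m univ ∂μ = μ.prod (volume.restrict (Ioc 0 1)) B := by
  rw [Measure.prod_apply hB]
  refine lintegral_congr fun m => ?_
  rw [fibreMeasure, Measure.restrict_apply_univ]

theorem measurable_edgeDensity {B : Set (M × ℝ)} (hB : MeasurableSet B) (k : ℕ) :
    Measurable (edgeDensity B k) :=
  (((measurable_fibreMeasure_Iic hB).pow_const _).const_mul _).indicator hB

theorem lintegral_edgeDensity {B : Set (M × ℝ)} (hB : MeasurableSet B) (k : ℕ) (m : M) :
    ∫⁻ x in Ioc 0 1, ‖edgeDensity B k (m, x)‖ₑ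
      = ENNReal.ofReal ((fibreMeasure B m).real univ ^ (k + 1 : ℝ)⁻¹) := by
  rw [← lintegral_rpow_measureReal_Iic _ (by positivity), lintegral_fibreMeasure hB]
  refine lintegral_congr fun x => ?_
  rw [Real.enorm_eq_ofReal (edgeDensity_nonneg B k _)]
  by_cases h : (m, x) ∈ B <;> simp [edgeDensity, h]

theorem lintegral_edgeDensity_le_one {B : Set (M × ℝ)} (hB : MeasurableSet B) (k : ℕ) (m : M) :
    ∫⁻ x in Ioc 0 1, ‖edgeDensity B k (m, x)‖ₑ ≤ 1 := by
  rw [lintegral_edgeDensity hB]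
  exact ENNReal.ofReal_le_one.2 (Real.rpow_le_one measureReal_nonneg
    (fibreMeasure_real_univ_le B m) (by positivity))

end FibreMeasure

/-- A cocycle over the action of `G` on `(M, μ)` with values in the group of orientation-preserving
`C¹` diffeomorphisms of `[0, 1]`.  It is encoded by the derivatives of the diffeomorphisms, which
are extended to the whole line; the diffeomorphisms themselves are the primitives
`IntervalCocycle.toFun`. -/
structure IntervalCocycle (G : Type*) {M : Type*} [Group G] [MulAction G M] [MeasurableSpace G]
    [MeasurableSpace M] (μ : Measure M) where
  deriv : G → M → ℝ → ℝ
  measurable_deriv : Measurable fun p : G × M × ℝ => deriv p.1 p.2.1 p.2.2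
  continuous_deriv : ∀ g m, Continuous (deriv g m)
  deriv_pos : ∀ g m x, 0 < deriv g m x
  integral_deriv : ∀ g m, ∫ x in (0 : ℝ)..1, deriv g m x = 1
  cocycle : ∀ g h, ∀ᵐ m ∂μ, ∀ x : ℝ, ∫ t in (0 : ℝ)..x, deriv (g * h) m t
    = ∫ t in (0 : ℝ)..(∫ u in (0 : ℝ)..x, deriv h m u), deriv g (h • m) t

namespace IntervalCocycle

variable {G M : Type*} [Group G] [MulAction G M] [MeasurableSpace G] [MeasurableSpace M]
  {μ : Measure M} (β : IntervalCocycle G μ)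

/-- The diffeomorphism of `[0, 1]` that an interval cocycle assigns to `(g, m)`. -/
def toFun (g : G) (m : M) (x : ℝ) : ℝ := ∫ t in (0 : ℝ)..x, β.deriv g m t

theorem hasDerivAt (g : G) (m : M) (x : ℝ) : HasDerivAt (β.toFun g m) (β.deriv g m x) x :=
  intervalIntegral.integral_hasDerivAt_right ((β.continuous_deriv g m).intervalIntegrable _ _)
    ((β.continuous_deriv g m).stronglyMeasurableAtFilter _ _) (β.continuous_deriv g m).continuousAt

theorem continuous_toFun (g : G) (m : M) : Continuous (β.toFun g m) :=
  continuous_iff_continuousAt.2 fun x => (β.hasDerivAt g m x).continuousAt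

theorem strictMono_toFun (g : G) (m : M) : StrictMono (β.toFun g m) :=
  strictMono_of_deriv_pos fun x => by rw [(β.hasDerivAt g m x).deriv]; exact β.deriv_pos g m x

@[simp]
theorem toFun_zero (g : G) (m : M) : β.toFun g m 0 = 0 := intervalIntegral.integral_same

@[simp]
theorem toFun_one (g : G) (m : M) : β.toFun g m 1 = 1 := β.integral_deriv g m

theorem toFun_mul (g h : G) :
    ∀ᵐ m ∂μ, ∀ x, β.toFun (g * h) m x = β.toFun g (h • m) (β.toFun h m x) := β.cocycle g h

theorem deriv_mul (g h : G) : ∀ᵐ m ∂μ, ∀ x,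
    β.deriv (g * h) m x = β.deriv g (h • m) (β.toFun h m x) * β.deriv h m x := by
  filter_upwards [β.toFun_mul g h] with m hm x
  have h1 := β.hasDerivAt (g * h) m x
  rw [show β.toFun (g * h) m = β.toFun g (h • m) ∘ β.toFun h m from funext hm] at h1
  exact h1.unique ((β.hasDerivAt g (h • m) _).comp x (β.hasDerivAt h m x))

theorem toFun_one_left : ∀ᵐ m ∂μ, ∀ x, β.toFun 1 m x = x := by
  filter_upwards [β.toFun_mul 1 1] with m hm x
  have h1 := hm x
  rw [mul_one, one_smul] at h1
  exact ((β.strictMono_toFun 1 m).injective h1).symm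

theorem deriv_one_left : ∀ᵐ m ∂μ, ∀ x, β.deriv 1 m x = 1 := by
  filter_upwards [β.toFun_one_left] with m hm x
  have h1 := β.hasDerivAt 1 m x
  rw [show β.toFun 1 m = id from funext hm] at h1
  exact h1.unique (hasDerivAt_id x)

theorem image_Ioc (g : G) (m : M) {x : ℝ} (hx : 0 ≤ x) :
    β.toFun g m '' Ioc 0 x = Ioc 0 (β.toFun g m x) := by
  refine Subset.antisymm ?_ fun y hy => ?_
  · rintro _ ⟨t, ht, rfl⟩
    exact ⟨by simpa using β.strictMono_toFun g m ht.1, (β.strictMono_toFun g m).monotone ht.2⟩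
  · obtain ⟨t, ht, rfl⟩ := intermediate_value_Icc hx (β.continuous_toFun g m).continuousOn
      ⟨by simpa using hy.1.le, hy.2⟩
    refine ⟨t, ⟨?_, ht.2⟩, rfl⟩
    have := hy.1
    rw [← β.toFun_zero g m] at this
    exact (β.strictMono_toFun g m).lt_iff_lt.1 this

theorem lintegral_comp_mul (g : G) (m : M) {x : ℝ} (hx : 0 ≤ x) (F : ℝ → ℝ≥0∞) :
    ∫⁻ t in Ioc 0 x, F (β.toFun g m t) * ENNReal.ofReal (β.deriv g m t)
      = ∫⁻ y in Ioc 0 (β.toFun g m x), F y := by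
  rw [← β.image_Ioc g m hx, lintegral_image_eq_lintegral_abs_deriv_mul measurableSet_Ioc
    (fun t _ => (β.hasDerivAt g m t).hasDerivWithinAt) (β.strictMono_toFun g m).injective.injOn]
  refine lintegral_congr fun t => ?_
  rw [abs_of_pos (β.deriv_pos g m t), mul_comm]

theorem lintegral_unit_comp_mul (g : G) (m : M) (F : ℝ → ℝ≥0∞) :
    ∫⁻ t in Ioc 0 1, F (β.toFun g m t) * ENNReal.ofReal (β.deriv g m t) = ∫⁻ y in Ioc 0 1, F y := by
  rw [β.lintegral_comp_mul g m zero_le_one, β.toFun_one]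

theorem measurable_toFun : Measurable fun p : G × M × ℝ => β.toFun p.1 p.2.1 p.2.2 := by
  have h : Measurable (Function.uncurry fun (x : ℝ) (p : G × M) => β.toFun p.1 p.2 x) := by
    refine measurable_uncurry_of_continuous_of_measurable
      (fun p => β.continuous_toFun p.1 p.2) fun x => ?_
    have hD : StronglyMeasurable fun q : (G × M) × ℝ => β.deriv q.1.1 q.1.2 q.2 :=
      (β.measurable_deriv.comp
        (measurable_fst.fst.prodMk (measurable_fst.snd.prodMk measurable_snd))).stronglyMeasurable
    exact (hD.integral_prod_right' (ν := volume.restrict (Ioc 0 x))).measurable.sub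
      (hD.integral_prod_right' (ν := volume.restrict (Ioc x 0))).measurable
  exact h.comp (measurable_snd.snd.prodMk (measurable_fst.prodMk measurable_snd.fst))

/-- The skew product `M × [0, 1]` of an interval cocycle, with the map
`(m, x) ↦ (gm, β(g,m)x)` and its Jacobian for `μ × λ`. -/
def nonsingularAction [MeasurableSMul₂ G M] [SFinite μ] [SMulInvariantMeasure G M μ] :
    NonsingularAction G (μ.prod (volume.restrict (Ioc (0 : ℝ) 1))) where
  map g p := (g • p.1, β.toFun g p.1 p.2)
  jac g p := β.deriv g p.1 p.2
  measurable_map := (measurable_fst.smul measurable_snd.fst).prodMk β.measurable_toFun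
  measurable_jac := β.measurable_deriv
  hasJacobian g :=
    have h1 : Measurable fun p : M × ℝ => β.toFun g p.1 p.2 :=
      β.measurable_toFun.comp (measurable_const.prodMk measurable_id)
    have h2 : Measurable fun p : M × ℝ => β.deriv g p.1 p.2 :=
      β.measurable_deriv.comp (measurable_const.prodMk measurable_id)
    { measurable := (measurable_fst.const_smul g).prodMk h1
      measurable_jac := h2
      pos := fun p => β.deriv_pos g p.1 p.2
      lintegral_comp_mul := fun F hF => by
        have hm : Measurable fun p : M × ℝ =>
            F (g • p.1, β.toFun g p.1 p.2) * ENNReal.ofReal (β.deriv g p.1 p.2) :=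
          (hF.comp ((measurable_fst.const_smul g).prodMk h1)).mul h2.ennreal_ofReal
        rw [lintegral_prod _ hm.aemeasurable, lintegral_prod _ hF.aemeasurable,
          ← (measurePreserving_smul g μ).lintegral_comp hF.lintegral_prod_right']
        exact lintegral_congr fun m => β.lintegral_unit_comp_mul g m fun y => F (g • m, y) }
  map_one := by
    have h : ∀ᵐ p ∂μ.prod (volume.restrict (Ioc (0 : ℝ) 1)),
        (∀ x, β.toFun 1 p.1 x = x) ∧ ∀ x, β.deriv 1 p.1 x = 1 :=
      Measure.quasiMeasurePreserving_fst.ae (β.toFun_one_left.and β.deriv_one_left)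
    filter_upwards [h] with p hp
    exact ⟨by rw [hp.1, one_smul], hp.2 _⟩
  map_mul g h := by
    have h : ∀ᵐ p ∂μ.prod (volume.restrict (Ioc (0 : ℝ) 1)),
        (∀ x, β.toFun (g * h) p.1 x = β.toFun g (h • p.1) (β.toFun h p.1 x)) ∧
        ∀ x, β.deriv (g * h) p.1 x
          = β.deriv g (h • p.1) (β.toFun h p.1 x) * β.deriv h p.1 x :=
      Measure.quasiMeasurePreserving_fst.ae ((β.toFun_mul g h).and (β.deriv_mul g h))
    filter_upwards [h] with p hp
    exact ⟨by rw [hp.1, mul_smul], hp.2 _⟩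

/-- On an invariant set, the distribution functions of the fibres are transformed by integrating
the derivative of the diffeomorphism. -/
theorem fibreMeasure_real_Iic_toFun {B : Set (M × ℝ)} (hB : MeasurableSet B) (g : G) {m : M}
    (hm : ∀ᵐ x ∂volume.restrict (Ioc (0 : ℝ) 1), (g • m, β.toFun g m x) ∈ B ↔ (m, x) ∈ B)
    {x : ℝ} (hx : x ∈ Ioc (0 : ℝ) 1) :
    (fibreMeasure B (g • m)).real (Iic (β.toFun g m x))
      = ∫ t in Iic x, β.deriv g m t ∂fibreMeasure B m := by
  have hx1 : β.toFun g m x ≤ 1 := by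
    rw [← β.toFun_one g m]; exact (β.strictMono_toFun g m).monotone hx.2
  have e1 : fibreMeasure B (g • m) (Iic (β.toFun g m x))
      = ∫⁻ y in Ioc 0 (β.toFun g m x), B.indicator 1 (g • m, y) := by
    rw [fibreMeasure, Measure.restrict_apply measurableSet_Iic, inter_comm,
      ← Measure.restrict_apply' measurableSet_Iic, Measure.restrict_restrict measurableSet_Iic,
      inter_comm, Ioc_inter_Iic, min_eq_right hx1,
      ← lintegral_indicator_one (measurable_prodMk_left hB)]
    rfl
  have e2 : ∫⁻ t in Iic x, ENNReal.ofReal (β.deriv g m t) ∂fibreMeasure B m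
      = ∫⁻ t in Ioc 0 x, B.indicator 1 (m, t) * ENNReal.ofReal (β.deriv g m t) := by
    rw [fibreMeasure, Measure.restrict_comm measurableSet_Iic,
      Measure.restrict_restrict measurableSet_Iic, inter_comm (Iic x), Ioc_inter_Iic,
      min_eq_right hx.2, ← lintegral_indicator (measurable_prodMk_left hB)]
    refine lintegral_congr fun t => ?_
    by_cases h : (m, t) ∈ B <;> simp [indicator, h]
  rw [integral_eq_lintegral_of_nonneg_ae
    (Eventually.of_forall fun t => (β.deriv_pos g m t).le)
    (β.continuous_deriv g m).aestronglyMeasurable, e2, Measure.real, e1,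
    ← β.lintegral_comp_mul g m hx.1.le]
  congr 1
  refine lintegral_congr_ae ?_
  filter_upwards [ae_restrict_of_ae_restrict_of_subset (Ioc_subset_Ioc_right hx.2) hm] with t ht
  by_cases h : (m, t) ∈ B <;> simp [indicator, h, ht]

/-- Under an interval cocycle, the edge densities of an invariant set are almost invariant on almost
every fibre. -/
theorem tendsto_lintegral_edgeDensity_sub {B : Set (M × ℝ)} (hB : MeasurableSet B) (g : G) {m : M}
    (hm : ∀ᵐ x ∂volume.restrict (Ioc (0 : ℝ) 1), (g • m, β.toFun g m x) ∈ B ↔ (m, x) ∈ B) :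
    Tendsto (fun k => ∫⁻ x in Ioc 0 1, ‖edgeDensity B k (g • m, β.toFun g m x) * β.deriv g m x
      - edgeDensity B k (m, x)‖ₑ) atTop (𝓝 0) := by
  have h01 : ∀ᵐ x ∂fibreMeasure B m, x ∈ Icc (0 : ℝ) 1 := by
    refine ae_restrict_of_ae ?_
    filter_upwards [ae_restrict_mem measurableSet_Ioc] with x hx using Ioc_subset_Icc_self hx
  refine (tendsto_lintegral_rpow_sub h01 (fibreMeasure_real_univ_le B m)
    (β.continuous_deriv g m) (β.deriv_pos g m)).congr fun k => ?_
  rw [lintegral_fibreMeasure hB]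
  refine lintegral_congr_ae ?_
  filter_upwards [hm, ae_restrict_mem measurableSet_Ioc] with x hx hx01
  by_cases h : (m, x) ∈ B
  · simp only [edgeDensity, indicator, h, hx.2 h, if_true,
      β.fibreMeasure_real_Iic_toFun hB g hm hx01]
  · simp [edgeDensity, indicator, h, hx]

/-- For a group with property (T), the skew product of an interval cocycle has a finite invariant
measure equivalent to `μ × λ`. -/
theorem exists_invariant_density [TopologicalSpace G] [IsTopologicalGroup G]
    [LocallyCompactSpace G] [T2Space G] [BorelSpace G] (hT : KazhdanPropertyT G)
    [MeasurableSpace.CountablyGenerated M] [MeasurableSMul₂ G M] [IsFiniteMeasure μ]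
    [SMulInvariantMeasure G M μ] :
    ∃ ψ : M × ℝ → ℝ≥0∞, Measurable ψ ∧
      ∫⁻ p, ψ p ∂μ.prod (volume.restrict (Ioc (0 : ℝ) 1)) ≠ ∞ ∧
      (∀ g, ∀ᵐ p ∂μ.prod (volume.restrict (Ioc (0 : ℝ) 1)),
        ψ (g • p.1, β.toFun g p.1 p.2) * ENNReal.ofReal (β.deriv g p.1 p.2) = ψ p) ∧
      ∀ᵐ p ∂μ.prod (volume.restrict (Ioc (0 : ℝ) 1)), ψ p ≠ 0 := by
  obtain ⟨ψ, hψm, hψi, hψinv, hψ⟩ := β.nonsingularAction.exists_invariant_density_of_kazhdan hT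
  refine ⟨ψ, hψm, hψi, hψinv, ?_⟩
  by_contra hcon
  set B : Set (M × ℝ) := {p | ψ p = 0} with hBdef
  have hB : MeasurableSet B := measurableSet_eq_fun hψm measurable_const
  have hBpos : μ.prod (volume.restrict (Ioc (0 : ℝ) 1)) B ≠ 0 := by
    simpa [ae_iff, hBdef] using hcon
  have hprod : ∀ k, ∫⁻ p, ‖edgeDensity B k p‖ₑ ∂μ.prod (volume.restrict (Ioc (0 : ℝ) 1))
      = ∫⁻ m, (∫⁻ x in Ioc 0 1, ‖edgeDensity B k (m, x)‖ₑ) ∂μ := fun k =>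
    lintegral_prod _ (measurable_edgeDensity hB k).enorm.aemeasurable
  refine hψ (edgeDensity B) _ (measurable_edgeDensity hB) (edgeDensity_nonneg B)
    (fun k p hp => indicator_of_notMem (s := B) hp _) hBpos (fun k => ?_) (fun k => ?_) fun g => ?_
  · -- the mass on a fibre is `H ^ s ≥ H`, for `H ≤ 1` the length of the fibre of `B`
    rw [hprod, ← lintegral_fibreMeasure_univ hB]
    refine lintegral_mono fun m => ?_
    rw [lintegral_edgeDensity hB, ← ofReal_measureReal]
    refine ENNReal.ofReal_le_ofReal ?_
    exact Real.self_le_rpow_of_le_one measureReal_nonneg (fibreMeasure_real_univ_le B m)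
      (inv_le_one_of_one_le₀ (by linarith [k.cast_nonneg (α := ℝ)]))
  · rw [hprod]
    refine ne_top_of_le_ne_top (measure_ne_top μ univ)
      ((lintegral_mono fun m => lintegral_edgeDensity_le_one hB k m).trans ?_)
    simp
  · change Tendsto (fun k => ∫⁻ p, ‖edgeDensity B k (g • p.1, β.toFun g p.1 p.2)
      * β.deriv g p.1 p.2 - edgeDensity B k p‖ₑ ∂μ.prod (volume.restrict (Ioc (0 : ℝ) 1)))
      atTop (𝓝 0)
    have hT : Measurable fun p : M × ℝ => (g • p.1, β.toFun g p.1 p.2) :=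
      (β.nonsingularAction.hasJacobian g).measurable
    have hJ : Measurable fun p : M × ℝ => β.deriv g p.1 p.2 :=
      (β.nonsingularAction.hasJacobian g).measurable_jac
    have hm : ∀ k, Measurable fun p : M × ℝ => ‖edgeDensity B k (g • p.1, β.toFun g p.1 p.2)
        * β.deriv g p.1 p.2 - edgeDensity B k p‖ₑ := fun k =>
      ((((measurable_edgeDensity hB k).comp hT).mul hJ).sub (measurable_edgeDensity hB k)).enorm
    have hinv : ∀ᵐ m ∂μ, ∀ᵐ x ∂volume.restrict (Ioc (0 : ℝ) 1),
        (g • m, β.toFun g m x) ∈ B ↔ (m, x) ∈ B := by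
      have h : ∀ᵐ p ∂μ.prod (volume.restrict (Ioc (0 : ℝ) 1)),
          (g • p.1, β.toFun g p.1 p.2) ∈ B ↔ (p.1, p.2) ∈ B := by
        filter_upwards [hψinv g] with p hp
        change ψ (g • p.1, β.toFun g p.1 p.2) * ENNReal.ofReal (β.deriv g p.1 p.2) = ψ p at hp
        change ψ _ = 0 ↔ ψ p = 0
        rw [← hp, mul_eq_zero, ENNReal.ofReal_eq_zero]
        simp [(β.deriv_pos g p.1 p.2).not_ge]
      exact Measure.ae_ae_of_ae_prod h
    refine Tendsto.congr (fun k => (lintegral_prod _ (hm k).aemeasurable).symm) ?_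
    rw [← lintegral_zero (μ := μ)]
    refine tendsto_lintegral_of_dominated_convergence (fun _ => 2)
      (fun k => (hm k).lintegral_prod_right') (fun k => Eventually.of_forall fun m => ?_)
      (by simpa using ENNReal.mul_ne_top ENNReal.ofNat_ne_top (measure_ne_top μ univ))
      (hinv.mono fun m hm => β.tendsto_lintegral_edgeDensity_sub hB g hm)
    have hq : Measurable fun x => ‖edgeDensity B k (m, x)‖ₑ :=
      ((measurable_edgeDensity hB k).comp measurable_prodMk_left).enorm
    calc ∫⁻ x in Ioc 0 1, ‖edgeDensity B k (g • m, β.toFun g m x) * β.deriv g m x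
          - edgeDensity B k (m, x)‖ₑ
        ≤ ∫⁻ x in Ioc 0 1, (‖edgeDensity B k (g • m, β.toFun g m x)‖ₑ
            * ENNReal.ofReal (β.deriv g m x) + ‖edgeDensity B k (m, x)‖ₑ) := by
          refine lintegral_mono fun x => (enorm_sub_le).trans ?_
          rw [enorm_mul, Real.enorm_eq_ofReal (β.deriv_pos g m x).le]
      _ = (∫⁻ x in Ioc 0 1, ‖edgeDensity B k (g • m, x)‖ₑ)
            + ∫⁻ x in Ioc 0 1, ‖edgeDensity B k (m, x)‖ₑ := by
          rw [lintegral_add_right _ hq,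
            β.lintegral_unit_comp_mul g m fun y => ‖edgeDensity B k (g • m, y)‖ₑ]
      _ ≤ 1 + 1 := add_le_add (lintegral_edgeDensity_le_one hB k _)
          (lintegral_edgeDensity_le_one hB k _)
      _ = 2 := one_add_one_eq_two

end IntervalCocycle

end IntervalCocycles

/-! ### Homeomorphisms of the circle -/

section CircleHomeomorphisms

open Filter Topology Set
open scoped ENNReal

theorem UnitAddCircle.coe_eq_coe_iff_exists_int {x y : ℝ} :
    (x : UnitAddCircle) = (y : UnitAddCircle) ↔ ∃ n : ℤ, x = y + n := by
  rw [← sub_eq_zero, ← AddCircle.coe_sub, AddCircle.coe_eq_zero_iff]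
  refine exists_congr fun n => ?_
  rw [zsmul_eq_mul, mul_one, eq_sub_iff_add_eq, eq_comm, add_comm]

theorem measurePreserving_coe_unitAddCircle : MeasurePreserving (fun x : ℝ => (x : UnitAddCircle))
    (volume.restrict (Ioc (0 : ℝ) 1)) volume := by
  simpa using UnitAddCircle.measurePreserving_mk 0

/-- Two increasing lifts of the same homeomorphism differ by an integer. -/
theorem IsIncreasingLift.exists_int_eq_add {F F' : ℝ ≃o ℝ} {φ : UnitAddCircle ≃ₜ UnitAddCircle}
    (h : IsIncreasingLift F φ) (h' : IsIncreasingLift F' φ) : ∃ n : ℤ, ∀ x, F x = F' x + n := by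
  have hint : ∀ x, ∃ n : ℤ, F x = F' x + n := fun x =>
    UnitAddCircle.coe_eq_coe_iff_exists_int.1 (by rw [← h x, ← h' x])
  choose n hn using hint
  have hc : Continuous fun x => (n x : ℝ) := by
    have e : (fun x => (n x : ℝ)) = fun x => F x - F' x := by
      funext x; rw [hn x]; ring
    rw [e]
    exact F.continuous.sub F'.continuous
  have hc' : Continuous n := Int.isClosedEmbedding_coe_real.isInducing.continuous_iff.2 hc
  refine ⟨n 0, fun x => ?_⟩
  rw [hn x, PreconnectedSpace.constant inferInstance hc' (x := x) (y := 0)]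

/-- Increasing lifts of homeomorphisms of the circle have degree one. -/
theorem IsIncreasingLift.map_add_one {F : ℝ ≃o ℝ} {φ : UnitAddCircle ≃ₜ UnitAddCircle}
    (h : IsIncreasingLift F φ) (x : ℝ) : F (x + 1) = F x + 1 := by
  obtain ⟨n, hn⟩ : ∃ n : ℤ, F (x + 1) = F x + n :=
    UnitAddCircle.coe_eq_coe_iff_exists_int.1 (by
      rw [← h, ← h]
      congr 1
      exact AddCircle.coe_add_period 1 x)
  have hlt : F x < F (x + 1) := F.strictMono (lt_add_one x)
  have hn0 : 0 < n := by
    rw [hn] at hlt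
    exact_mod_cast (lt_add_iff_pos_right _).1 hlt
  have hn1 : n ≤ 1 := by
    by_contra! hn2
    -- otherwise a point strictly between `x` and `x + 1` has the same image in the circle as `x`
    set y := F.symm (F x + 1)
    have hFy : F y = F x + 1 := F.apply_symm_apply _
    have hxy : x < y := F.lt_iff_lt.1 (by rw [hFy]; exact lt_add_one _)
    have hyx : y < x + 1 := F.lt_iff_lt.1 (by
      rw [hFy, hn]
      have : (1 : ℝ) < n := by exact_mod_cast hn2
      linarith)
    have e : (y : UnitAddCircle) = x := φ.injective (by
      rw [h, h, hFy]; exact AddCircle.coe_add_period 1 _)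
    obtain ⟨k, hk⟩ := UnitAddCircle.coe_eq_coe_iff_exists_int.1 e
    rw [hk] at hxy hyx
    have h1 : (0 : ℝ) < k := by linarith
    have h2 : (k : ℝ) < 1 := by linarith
    have h3 : 0 < k := by exact_mod_cast h1
    have h4 : k < 1 := by exact_mod_cast h2
    omega
  have : n = 1 := le_antisymm hn1 hn0
  rw [hn, this, Int.cast_one]

theorem map_add_intCast_of_map_add_one {F : ℝ → ℝ} (h : ∀ x, F (x + 1) = F x + 1) (x : ℝ) (n : ℤ) :
    F (x + n) = F x + n := by
  have hp : Function.Periodic (fun x => F x - x) 1 := fun x => by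
    change F (x + 1) - (x + 1) = F x - x
    rw [h]; ring
  have := hp.int_mul n x
  simp only [mul_one] at this
  linarith

/-- The homeomorphism of the circle with a given lift of degree one. -/
def circleHomeo (F : ℝ ≃o ℝ) (hF : ∀ x, F (x + 1) = F x + 1) : UnitAddCircle ≃ₜ UnitAddCircle :=
  have hs : ∀ x, F.symm (x + 1) = F.symm x + 1 := fun x => by
    rw [OrderIso.symm_apply_eq, hF, F.apply_symm_apply]
  have hper : ∀ E : ℝ ≃o ℝ, (∀ x, E (x + 1) = E x + 1) →
      Function.Periodic (fun x => (E x : UnitAddCircle)) 1 := fun E hE x => by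
    change ((E (x + 1) : ℝ) : UnitAddCircle) = E x
    rw [hE]; exact AddCircle.coe_add_period 1 _
  { toFun := (hper F hF).lift
    invFun := (hper F.symm hs).lift
    left_inv := fun s => by
      obtain ⟨x, rfl⟩ := QuotientAddGroup.mk_surjective s
      change ((F.symm (F x) : ℝ) : UnitAddCircle) = x
      rw [F.symm_apply_apply]
    right_inv := fun s => by
      obtain ⟨x, rfl⟩ := QuotientAddGroup.mk_surjective s
      change ((F (F.symm x) : ℝ) : UnitAddCircle) = x
      rw [F.apply_symm_apply]
    continuous_toFun := (QuotientAddGroup.isQuotientMap_mk _).continuous_iff.2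
      ((AddCircle.continuous_mk' 1).comp F.continuous)
    continuous_invFun := (QuotientAddGroup.isQuotientMap_mk _).continuous_iff.2
      ((AddCircle.continuous_mk' 1).comp F.symm.continuous) }

theorem isIncreasingLift_circleHomeo (F : ℝ ≃o ℝ) (hF : ∀ x, F (x + 1) = F x + 1) :
    IsIncreasingLift F (circleHomeo F hF) := fun _ => rfl

/-- The extension `x ↦ ⌊x⌋ + Φ (x - ⌊x⌋)` to the line of an increasing homeomorphism `Φ` of the unit
interval. -/
def periodicExtension (Φ : ℝ → ℝ) (hc : ContinuousOn Φ (Icc 0 1)) (hm : StrictMonoOn Φ (Icc 0 1))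
    (h0 : Φ 0 = 0) (h1 : Φ 1 = 1) : ℝ ≃o ℝ :=
  StrictMono.orderIsoOfSurjective (fun x => ⌊x⌋ + Φ (Int.fract x))
    (fun x y hxy => by
      have hI : ∀ x : ℝ, Int.fract x ∈ Icc (0 : ℝ) 1 := fun x =>
        ⟨Int.fract_nonneg x, (Int.fract_lt_one x).le⟩
      change (⌊x⌋ : ℝ) + Φ (Int.fract x) < ⌊y⌋ + Φ (Int.fract y)
      rcases (Int.floor_mono hxy.le).eq_or_lt with h | h
      · rw [h]
        gcongr
        refine hm (hI x) (hI y) ?_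
        rw [Int.fract, Int.fract, h]
        linarith
      · have h2 : (⌊x⌋ : ℝ) + 1 ≤ ⌊y⌋ := by exact_mod_cast h
        have h3 : Φ (Int.fract x) < 1 := by
          rw [← h1]; exact hm (hI x) (right_mem_Icc.2 zero_le_one) (Int.fract_lt_one x)
        have h4 : 0 ≤ Φ (Int.fract y) := by
          rw [← h0]
          exact hm.monotoneOn (left_mem_Icc.2 zero_le_one) (hI y) (Int.fract_nonneg y)
        linarith)
    (fun y => by
      obtain ⟨t, ht, hty⟩ := intermediate_value_Icc zero_le_one hc
        (show Int.fract y ∈ Icc (Φ 0) (Φ 1) by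
          rw [h0, h1]; exact ⟨Int.fract_nonneg y, (Int.fract_lt_one y).le⟩)
      have ht1 : t < 1 := ht.2.lt_of_ne fun h => by
        rw [h, h1] at hty
        exact (Int.fract_lt_one y).ne hty.symm
      refine ⟨⌊y⌋ + t, ?_⟩
      have e1 : ⌊(⌊y⌋ : ℝ) + t⌋ = ⌊y⌋ := by
        rw [Int.floor_intCast_add, Int.floor_eq_zero_iff.2 ⟨ht.1, ht1⟩, add_zero]
      have e2 : Int.fract ((⌊y⌋ : ℝ) + t) = t := by
        rw [Int.fract, e1, add_sub_cancel_left]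
      change (⌊(⌊y⌋ : ℝ) + t⌋ : ℝ) + Φ (Int.fract ((⌊y⌋ : ℝ) + t)) = y
      rw [e1, e2, hty, Int.floor_add_fract])

theorem periodicExtension_apply {Φ : ℝ → ℝ} (hc : ContinuousOn Φ (Icc 0 1))
    (hm : StrictMonoOn Φ (Icc 0 1)) (h0 : Φ 0 = 0) (h1 : Φ 1 = 1) (x : ℝ) :
    periodicExtension Φ hc hm h0 h1 x = ⌊x⌋ + Φ (Int.fract x) := rfl

theorem periodicExtension_add_one {Φ : ℝ → ℝ} (hc : ContinuousOn Φ (Icc 0 1))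
    (hm : StrictMonoOn Φ (Icc 0 1)) (h0 : Φ 0 = 0) (h1 : Φ 1 = 1) (x : ℝ) :
    periodicExtension Φ hc hm h0 h1 (x + 1) = periodicExtension Φ hc hm h0 h1 x + 1 := by
  rw [periodicExtension_apply, periodicExtension_apply, Int.floor_add_one, Int.fract_add_one]
  push_cast
  ring

theorem periodicExtension_eq {Φ : ℝ → ℝ} (hc : ContinuousOn Φ (Icc 0 1))
    (hm : StrictMonoOn Φ (Icc 0 1)) (h0 : Φ 0 = 0) (h1 : Φ 1 = 1) {x : ℝ} (hx : x ∈ Icc (0 : ℝ) 1) :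
    periodicExtension Φ hc hm h0 h1 x = Φ x := by
  rw [periodicExtension_apply]
  rcases hx.2.eq_or_lt with rfl | h
  · simp [h0, h1]
  · rw [Int.floor_eq_zero_iff.2 ⟨hx.1, h⟩, Int.fract_eq_self.2 ⟨hx.1, h⟩]
    simp

/-- The measure on the line with density `w` on the unit interval. -/
def unitDensity (w : ℝ → ℝ≥0∞) : Measure ℝ := (volume.restrict (Ioc 0 1)).withDensity w

/-- `w` is the density of a probability measure on the unit interval which is equivalent to Lebesgue
measure. -/
structure IsUnitDensity (w : ℝ → ℝ≥0∞) : Prop where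
  measurable : Measurable w
  lintegral_eq_one : ∫⁻ x in Ioc 0 1, w x = 1
  ae_ne_zero : ∀ᵐ x ∂volume.restrict (Ioc (0 : ℝ) 1), w x ≠ 0

theorem IsUnitDensity.isProbabilityMeasure {w : ℝ → ℝ≥0∞} (hw : IsUnitDensity w) :
    IsProbabilityMeasure (unitDensity w) :=
  ⟨by rw [unitDensity, withDensity_apply _ MeasurableSet.univ, Measure.restrict_univ,
    hw.lintegral_eq_one]⟩

instance (w : ℝ → ℝ≥0∞) : NullSingletonClass (unitDensity w) :=
  ⟨fun x => withDensity_absolutelyContinuous _ _ (measure_singleton x)⟩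

theorem unitDensity_Iic (w : ℝ → ℝ≥0∞) {x : ℝ} (hx : x ≤ 1) :
    unitDensity w (Iic x) = ∫⁻ t in Ioc 0 x, w t := by
  rw [unitDensity, withDensity_apply _ measurableSet_Iic,
    Measure.restrict_restrict measurableSet_Iic, inter_comm, Ioc_inter_Iic, min_eq_right hx]

/-- The distribution function of `unitDensity w`. -/
def unitCDF (w : ℝ → ℝ≥0∞) (x : ℝ) : ℝ := (unitDensity w).real (Iic x)

namespace IsUnitDensity

theorem continuous_unitCDF {w : ℝ → ℝ≥0∞} (hw : IsUnitDensity w) : Continuous (unitCDF w) :=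
  have := hw.isProbabilityMeasure
  continuous_measureReal_Iic _

theorem unitCDF_zero (w : ℝ → ℝ≥0∞) : unitCDF w 0 = 0 := by
  rw [unitCDF, Measure.real, unitDensity_Iic w zero_le_one]; simp

theorem unitCDF_one {w : ℝ → ℝ≥0∞} (hw : IsUnitDensity w) : unitCDF w 1 = 1 := by
  rw [unitCDF, Measure.real, unitDensity_Iic w le_rfl, hw.lintegral_eq_one, ENNReal.toReal_one]

theorem strictMonoOn_unitCDF {w : ℝ → ℝ≥0∞} (hw : IsUnitDensity w) :
    StrictMonoOn (unitCDF w) (Icc 0 1) := by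
  intro x hx y hy hxy
  have := hw.isProbabilityMeasure
  have hpos : unitDensity w (Ioc x y) ≠ 0 := fun h => by
    rw [unitDensity, withDensity_apply _ measurableSet_Ioc, lintegral_eq_zero_iff hw.measurable,
      Measure.restrict_restrict measurableSet_Ioc,
      inter_eq_left.2 (Ioc_subset_Ioc hx.1 hy.2)] at h
    have h2 : ∀ᵐ t ∂volume.restrict (Ioc x y), False := by
      filter_upwards [h, ae_restrict_of_ae_restrict_of_subset (Ioc_subset_Ioc hx.1 hy.2)
        hw.ae_ne_zero] with t h1 h2 using h2 h1
    rw [ae_iff] at h2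
    have h5 : y ≤ x := by simpa using h2
    exact hxy.not_ge h5
  have h3 : unitCDF w y = unitCDF w x + (unitDensity w).real (Ioc x y) := by
    rw [unitCDF, unitCDF, ← Iic_union_Ioc_eq_Iic hxy.le,
      measureReal_union (Iic_disjoint_Ioc le_rfl) measurableSet_Ioc]
  have h4 : 0 < (unitDensity w).real (Ioc x y) :=
    ENNReal.toReal_pos hpos (measure_ne_top _ _)
  linarith

/-- The lift to the line of the circle homeomorphism `straightening`. -/
def lift {w : ℝ → ℝ≥0∞} (hw : IsUnitDensity w) : ℝ ≃o ℝ :=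
  periodicExtension (unitCDF w) hw.continuous_unitCDF.continuousOn hw.strictMonoOn_unitCDF
    (unitCDF_zero w) hw.unitCDF_one

theorem lift_add_one {w : ℝ → ℝ≥0∞} (hw : IsUnitDensity w) (x : ℝ) :
    hw.lift (x + 1) = hw.lift x + 1 :=
  periodicExtension_add_one _ _ _ _ x

theorem lift_apply {w : ℝ → ℝ≥0∞} (hw : IsUnitDensity w) (x : ℝ) :
    hw.lift x = ⌊x⌋ + unitCDF w (Int.fract x) := rfl

/-- The homeomorphism of the circle which fixes `0` and maps the measure with density `w` to
Lebesgue measure. -/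
def straightening {w : ℝ → ℝ≥0∞} (hw : IsUnitDensity w) : UnitAddCircle ≃ₜ UnitAddCircle :=
  circleHomeo hw.lift hw.lift_add_one

theorem straightening_coe {w : ℝ → ℝ≥0∞} (hw : IsUnitDensity w) {x : ℝ} (hx : x ∈ Icc (0 : ℝ) 1) :
    hw.straightening (x : UnitAddCircle) = (unitCDF w x : UnitAddCircle) := by
  have h : hw.lift x = unitCDF w x := periodicExtension_eq _ _ _ _ hx
  rw [← h]
  exact isIncreasingLift_circleHomeo _ _ x

theorem map_straightening {w : ℝ → ℝ≥0∞} (hw : IsUnitDensity w) :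
    ((unitDensity w).map (fun x : ℝ => (x : UnitAddCircle))).map hw.straightening = volume := by
  have := hw.isProbabilityMeasure
  have hmk : Measurable (fun x : ℝ => (x : UnitAddCircle)) := AddCircle.measurable_mk'
  have hvol := measurePreserving_coe_unitAddCircle.map_eq
  have hae : ∀ᵐ x ∂unitDensity w, x ∈ Ioc (0 : ℝ) 1 :=
    (withDensity_absolutelyContinuous _ _).ae_le (ae_restrict_mem measurableSet_Ioc)
  have e : (hw.straightening ∘ fun x : ℝ => (x : UnitAddCircle)) =ᵐ[unitDensity w]
      (fun x : ℝ => (x : UnitAddCircle)) ∘ unitCDF w := by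
    filter_upwards [hae] with x hx using hw.straightening_coe (Ioc_subset_Icc_self hx)
  have h1 := map_measureReal_Iic (unitDensity w)
  rw [probReal_univ] at h1
  rw [Measure.map_map hw.straightening.measurable hmk, Measure.map_congr e,
    ← Measure.map_map hmk hw.continuous_unitCDF.measurable]
  exact (congrArg (Measure.map fun x : ℝ => (x : UnitAddCircle)) h1).trans hvol

theorem straightening_mem {w : ℝ → ℝ≥0∞} (hw : IsUnitDensity w) :
    hw.straightening ∈ HomeoLebPlus := by
  have hmk : Measurable (fun x : ℝ => (x : UnitAddCircle)) := AddCircle.measurable_mk'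
  have hvol := measurePreserving_coe_unitAddCircle.map_eq
  have h1 : (unitDensity w).map (fun x : ℝ => (x : UnitAddCircle)) ≪ volume := by
    have := (withDensity_absolutelyContinuous (volume.restrict (Ioc (0 : ℝ) 1)) w).map hmk
    rwa [hvol] at this
  have h2 : volume ≪ (unitDensity w).map (fun x : ℝ => (x : UnitAddCircle)) := by
    have := (withDensity_absolutelyContinuous' hw.measurable.aemeasurable hw.ae_ne_zero).map hmk
    rwa [hvol] at this
  refine ⟨⟨_, isIncreasingLift_circleHomeo _ _⟩, ?_, ?_⟩
  · have := h2.map hw.straightening.measurable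
    rwa [hw.map_straightening] at this
  · have := h1.map hw.straightening.measurable
    rwa [hw.map_straightening] at this

end IsUnitDensity

theorem addLeft_mem_homeoLebPlus (a : UnitAddCircle) : Homeomorph.addLeft a ∈ HomeoLebPlus := by
  have h : (volume : Measure UnitAddCircle).map (Homeomorph.addLeft a) = volume :=
    (measurePreserving_add_left volume a).map_eq
  obtain ⟨x, rfl⟩ := QuotientAddGroup.mk_surjective a
  refine ⟨⟨OrderIso.addLeft x, fun y => ?_⟩, ?_, ?_⟩
  · exact (AddCircle.coe_add 1 x y).symm
  · rw [h]
  · rw [h]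

/-- A map into `C(K, E)`, for a compact separable space `K`, is Borel as soon as its evaluations at
all points are Borel. -/
theorem measurable_continuousMap_of_eval {Ω K E : Type*} [MeasurableSpace Ω] [TopologicalSpace K]
    [CompactSpace K] [TopologicalSpace.SeparableSpace K] [Nonempty K] [MetricSpace E]
    [SecondCountableTopology E] [MeasurableSpace E] [OpensMeasurableSpace E]
    [TopologicalSpace.SeparableSpace C(K, E)] [MeasurableSpace C(K, E)] [BorelSpace C(K, E)]
    {u : Ω → C(K, E)} (hu : ∀ x, Measurable fun m => u m x) : Measurable u := by
  rcases isEmpty_or_nonempty Ω with _ | ⟨⟨m₀⟩⟩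
  · exact measurable_of_empty _
  have : Nonempty C(K, E) := ⟨u m₀⟩
  refine measurable_of_isOpen fun U hU => ?_
  let c : ℕ → C(K, E) := TopologicalSpace.denseSeq _
  let d : ℕ → K := TopologicalSpace.denseSeq _
  have e : u ⁻¹' U = ⋃ (n : ℕ) (k : ℕ)
      (_ : Metric.closedBall (c n) (1 / (k + 1 : ℝ)) ⊆ U),
        ⋂ j, {m | dist (u m (d j)) (c n (d j)) ≤ 1 / (k + 1 : ℝ)} := by
    ext m
    simp only [mem_preimage, mem_iUnion, mem_iInter, mem_ofPred_eq, exists_prop]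
    constructor
    · intro hm
      obtain ⟨ε, hε, hball⟩ := Metric.isOpen_iff.1 hU _ hm
      obtain ⟨k, hk⟩ := exists_nat_one_div_lt (half_pos hε)
      have hk0 : (0 : ℝ) < 1 / (k + 1 : ℝ) := by positivity
      obtain ⟨_, hx, ⟨n, rfl⟩⟩ := Metric.dense_iff.1
        (TopologicalSpace.denseRange_denseSeq C(K, E)) (u m) _ hk0
      rw [Metric.mem_ball, dist_comm] at hx
      refine ⟨n, k, fun f hf => hball ?_, fun j =>
        (ContinuousMap.dist_apply_le_dist _).trans hx.le⟩
      rw [Metric.mem_closedBall] at hf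
      rw [Metric.mem_ball]
      calc dist f (u m) ≤ dist f (c n) + dist (u m) (c n) := dist_triangle_right _ _ _
        _ < ε := by linarith [show dist (u m) (c n) < 1 / (k + 1 : ℝ) from hx]
    · rintro ⟨n, k, hsub, hj⟩
      refine hsub (Metric.mem_closedBall.2 ((ContinuousMap.dist_le (by positivity)).2 fun x => ?_))
      exact (TopologicalSpace.denseRange_denseSeq K).induction_on x
        (isClosed_le (by fun_prop) continuous_const) hj
  rw [e]
  refine MeasurableSet.iUnion fun n => MeasurableSet.iUnion fun k => MeasurableSet.iUnion fun _ =>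
    MeasurableSet.iInter fun j => ?_
  exact measurableSet_le ((hu _).dist measurable_const) measurable_const

theorem measurable_homeoLebPlus_of_eval {Ω : Type*} [MeasurableSpace Ω] {φ : Ω → HomeoLebPlus}
    (h : ∀ s, Measurable fun m => (φ m).1 s) : Measurable φ := by
  borelize C(UnitAddCircle, UnitAddCircle)
  have e : HomeoLebPlus.measurableSpace = MeasurableSpace.comap
      (fun φ : HomeoLebPlus => (⟨φ.1, φ.1.continuous⟩ : C(UnitAddCircle, UnitAddCircle)))
      (borel _) := borel_comap
  rw [e]
  exact measurable_comap_iff.2 (measurable_continuousMap_of_eval h)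

instance : BorelSpace Diff1Plus := ⟨rfl⟩

namespace Diff1Plus

theorem continuous_c1 : Continuous fun φ : Diff1Plus =>
    ((⟨φ.1, φ.1.continuous⟩ : C(UnitAddCircle, UnitAddCircle)), derivative φ) :=
  continuous_induced_dom

theorem continuous_derivative_apply (x : ℝ) : Continuous fun φ : Diff1Plus => derivative φ x := by
  have hc : Continuous fun φ : Diff1Plus => derivative φ := continuous_snd.comp continuous_c1
  exact (continuous_eval_const (F := C(ℝ, ℝ)) x).comp hc

theorem measurable_derivative {Ω : Type*} [MeasurableSpace Ω] {u : Ω → Diff1Plus} {v : Ω → ℝ}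
    (hu : Measurable u) (hv : Measurable v) : Measurable fun ω => derivative (u ω) (v ω) := by
  have h : Measurable (Function.uncurry fun (x : ℝ) (φ : Diff1Plus) => derivative φ x) :=
    measurable_uncurry_of_continuous_of_measurable (fun φ => (derivative φ).continuous)
      fun x => (continuous_derivative_apply x).measurable
  have e : (fun ω => derivative (u ω) (v ω))
      = (Function.uncurry fun (x : ℝ) (φ : Diff1Plus) => derivative φ x) ∘
        fun ω => (v ω, u ω) := rfl
  rw [e]
  exact h.comp (hv.prodMk hu)

theorem measurable_apply : Measurable fun p : Diff1Plus × UnitAddCircle => p.1.1 p.2 := by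
  have hc : Continuous fun φ : Diff1Plus =>
      (⟨φ.1, φ.1.continuous⟩ : C(UnitAddCircle, UnitAddCircle)) :=
    continuous_fst.comp continuous_c1
  have h : Measurable (Function.uncurry fun (s : UnitAddCircle) (φ : Diff1Plus) => φ.1 s) :=
    measurable_uncurry_of_continuous_of_measurable (fun φ => φ.1.continuous)
      fun x => ((continuous_eval_const x).comp hc).measurable
  exact h.comp measurable_swap

theorem hasDerivAt {φ : Diff1Plus} {F : ℝ ≃o ℝ} (hF : IsIncreasingLift F φ.1) (x : ℝ) :
    HasDerivAt F (derivative φ x) x := by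
  have hF0 := φ.2.choose_spec.1
  obtain ⟨n, hn⟩ := hF.exists_int_eq_add hF0
  rw [show (F : ℝ → ℝ) = fun x => φ.2.choose x + n from funext hn]
  exact ((φ.2.choose_spec.2.1.differentiable one_ne_zero x).hasDerivAt).add_const _

theorem derivative_pos (φ : Diff1Plus) (x : ℝ) : 0 < derivative φ x := by
  obtain ⟨F, hF, hF1, hF2⟩ := φ.2
  have h1 := hasDerivAt hF x
  have h2 := (hF2.differentiable one_ne_zero (F x)).hasDerivAt.comp x h1
  rw [show (F.symm : ℝ → ℝ) ∘ F = id from funext F.symm_apply_apply] at h2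
  have h3 := h2.unique (hasDerivAt_id x)
  have h4 : 0 ≤ derivative φ x := by
    rw [← h1.deriv]; exact F.monotone.deriv_nonneg
  refine h4.lt_of_ne fun h => ?_
  rw [← h, mul_zero] at h3
  exact zero_ne_one h3

theorem integral_derivative {φ : Diff1Plus} {F : ℝ ≃o ℝ} (hF : IsIncreasingLift F φ.1) (a x : ℝ) :
    ∫ t in (0 : ℝ)..x, derivative φ (a + t) = F (a + x) - F a := by
  rw [intervalIntegral.integral_comp_add_left, add_zero]
  exact intervalIntegral.integral_eq_sub_of_hasDerivAt (fun t _ => hasDerivAt hF t)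
    ((derivative φ).continuous.intervalIntegrable _ _)

theorem apply_coe_add (φ : Diff1Plus) (a x : ℝ) :
    φ.1 ((a + x : ℝ) : UnitAddCircle)
      = φ.1 (a : UnitAddCircle)
        + ((∫ t in (0 : ℝ)..x, derivative φ (a + t) : ℝ) : UnitAddCircle) := by
  obtain ⟨F, hF, -, -⟩ := φ.2
  rw [integral_derivative hF, hF, hF, AddCircle.coe_sub, add_sub_cancel]

end Diff1Plus

end CircleHomeomorphisms

/-! ### Cutting the circle open along the equivariant section -/

section Straightening

open Filter Topology Set
open scoped ENNReal

/-- An invariant density of the skew product can be normalised to a probability density on every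
fibre. -/
theorem IntervalCocycle.exists_invariant_unitDensity {G M : Type*} [Group G] [MulAction G M]
    [TopologicalSpace G] [IsTopologicalGroup G] [LocallyCompactSpace G] [T2Space G]
    [MeasurableSpace G] [BorelSpace G] (hT : KazhdanPropertyT G) [MeasurableSpace M]
    [MeasurableSpace.CountablyGenerated M] [MeasurableSMul₂ G M] {μ : Measure M} [IsFiniteMeasure μ]
    [SMulInvariantMeasure G M μ] (β : IntervalCocycle G μ) :
    ∃ Ψ : M × ℝ → ℝ≥0∞, Measurable Ψ ∧ (∀ m, IsUnitDensity fun x => Ψ (m, x)) ∧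
      ∀ g, ∀ᵐ p ∂μ.prod (volume.restrict (Ioc (0 : ℝ) 1)),
        Ψ (g • p.1, β.toFun g p.1 p.2) * ENNReal.ofReal (β.deriv g p.1 p.2) = Ψ p := by
  obtain ⟨ψ, hψm, hψi, hψinv, hψ0⟩ := β.exists_invariant_density hT
  have hψx : ∀ m, Measurable fun x => ψ (m, x) := fun m => hψm.comp measurable_prodMk_left
  let c : M → ℝ≥0∞ := fun m => ∫⁻ x in Ioc (0 : ℝ) 1, ψ (m, x)
  have hc : Measurable c := hψm.lintegral_prod_right'
  let A : Set M := {m | c m ≠ ∞ ∧ ∀ᵐ x ∂volume.restrict (Ioc (0 : ℝ) 1), ψ (m, x) ≠ 0}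
  have hA : MeasurableSet A := by
    have hZ : MeasurableSet {p : M × ℝ | ψ p = 0} := measurableSet_eq_fun hψm measurable_const
    have := measurableSet_eq_fun
      (measurable_measure_prodMk_left (ν := volume.restrict (Ioc (0 : ℝ) 1)) hZ)
      (measurable_const (a := (0 : ℝ≥0∞)))
    have e : A = {m | c m = ∞}ᶜ ∩
        {m | volume.restrict (Ioc (0 : ℝ) 1) (Prod.mk m ⁻¹' {p : M × ℝ | ψ p = 0}) = 0} := by
      ext m
      refine and_congr Iff.rfl ?_
      rw [ae_iff]
      simp only [not_not]
      rfl
    rw [e]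
    exact (measurableSet_eq_fun hc measurable_const).compl.inter this
  have hAae : ∀ᵐ m ∂μ, m ∈ A := by
    rw [lintegral_prod _ hψm.aemeasurable] at hψi
    have h0 : ∀ᵐ m ∂μ, ∀ᵐ x ∂volume.restrict (Ioc (0 : ℝ) 1), ψ (m, x) ≠ 0 :=
      Measure.ae_ae_of_ae_prod hψ0
    filter_upwards [ae_lt_top hc hψi, h0] with m h1 h2 using ⟨h1.ne, h2⟩
  have hc0 : ∀ m ∈ A, c m ≠ 0 := fun m hm h => by
    rw [lintegral_eq_zero_iff (hψx m)] at h
    have h2 : ∀ᵐ t ∂volume.restrict (Ioc (0 : ℝ) 1), False := by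
      filter_upwards [h, hm.2] with t h1 h2 using h2 h1
    rw [ae_iff] at h2
    simp at h2
  classical
  refine ⟨fun p => if p.1 ∈ A then ψ p / c p.1 else 1,
    Measurable.ite (measurable_fst hA) (hψm.div (hc.comp measurable_fst)) measurable_const,
    fun m => ?_, fun g => ?_⟩
  · by_cases hm : m ∈ A
    · simp only [hm, if_true]
      refine ⟨(hψx m).div_const _, ?_, ?_⟩
      · simp only [div_eq_mul_inv]
        rw [lintegral_mul_const _ (hψx m)]
        exact ENNReal.mul_inv_cancel (hc0 m hm) hm.1
      · filter_upwards [hm.2] with x hx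
        exact ENNReal.div_ne_zero.2 ⟨hx, hm.1⟩
    · simp only [hm, if_false]
      exact ⟨measurable_const, by simp, Eventually.of_forall fun _ => one_ne_zero⟩
  · have hinv : ∀ᵐ m ∂μ, ∀ᵐ x ∂volume.restrict (Ioc (0 : ℝ) 1),
        ψ (g • m, β.toFun g m x) * ENNReal.ofReal (β.deriv g m x) = ψ (m, x) :=
      Measure.ae_ae_of_ae_prod (hψinv g)
    have hcg : ∀ᵐ m ∂μ, c (g • m) = c m := by
      filter_upwards [hinv] with m hm
      change ∫⁻ y in Ioc (0 : ℝ) 1, ψ (g • m, y) = _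
      rw [← β.lintegral_unit_comp_mul g m fun y => ψ (g • m, y)]
      exact lintegral_congr_ae hm
    have hgood : ∀ᵐ p ∂μ.prod (volume.restrict (Ioc (0 : ℝ) 1)),
        p.1 ∈ A ∧ g • p.1 ∈ A ∧ c (g • p.1) = c p.1 :=
      Measure.quasiMeasurePreserving_fst.ae (hAae.and
        (((measurePreserving_smul g μ).quasiMeasurePreserving.ae hAae).and hcg))
    filter_upwards [hgood, hψinv g] with p ⟨h1, h2, h3⟩ h4
    rw [if_pos h1, if_pos h2, h3, ← h4, ENNReal.mul_div_right_comm]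

/-- The coordinate in `(0, 1]` of a point of the circle. -/
def circleCoord (s : UnitAddCircle) : ℝ := AddCircle.equivIoc 1 0 s

theorem measurable_circleCoord : Measurable circleCoord :=
  measurable_subtype_coe.comp (AddCircle.measurableEquivIoc 1 0).measurable

@[simp]
theorem coe_circleCoord (s : UnitAddCircle) : (circleCoord s : UnitAddCircle) = s :=
  AddCircle.coe_equivIoc

theorem exists_mem_Ioc_coe_eq (s : UnitAddCircle) : ∃ x ∈ Ioc (0 : ℝ) 1, (x : UnitAddCircle) = s :=
  ⟨circleCoord s, by simpa [circleCoord] using (AddCircle.equivIoc 1 0 s).2, coe_circleCoord s⟩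

/-- The homeomorphism of the circle that moves `0` to `f m` and Lebesgue measure to the measure with
density `w` (in the coordinate with origin `f m`). -/
def framing {M : Type*} {w : M → ℝ → ℝ≥0∞} (hw : ∀ m, IsUnitDensity (w m))
    (f : M → UnitAddCircle) (m : M) : HomeoLebPlus :=
  ⟨Homeomorph.addLeft (f m), addLeft_mem_homeoLebPlus _⟩
    * ⟨(hw m).straightening, (hw m).straightening_mem⟩⁻¹

theorem framing_straightening {M : Type*} {w : M → ℝ → ℝ≥0∞} (hw : ∀ m, IsUnitDensity (w m))
    (f : M → UnitAddCircle) (m : M) (s : UnitAddCircle) :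
    (framing hw f m).1 ((hw m).straightening s) = f m + s := by
  change f m + (hw m).straightening.symm ((hw m).straightening s) = f m + s
  rw [Homeomorph.symm_apply_apply]

variable {G M : Type*} [Group G] [MulAction G M] [MeasurableSpace G] [MeasurableSpace M]
  {μ : Measure M} {α : G × M → Diff1Plus} {f : M → UnitAddCircle}

/-- Cutting the circle open along an equivariant section `f` turns a cocycle of circle
diffeomorphisms into a cocycle of diffeomorphisms of the unit interval. -/
def cutOpen (hα : IsBorelCocycle μ α) (hf : Measurable f) (hfα : IsEquivariantMap μ α f) :
    IntervalCocycle G μ where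
  deriv g m x := Diff1Plus.derivative (α (g, m)) (circleCoord (f m) + x)
  measurable_deriv := Diff1Plus.measurable_derivative
    (hα.1.comp (measurable_fst.prodMk measurable_snd.fst))
    ((measurable_circleCoord.comp (hf.comp measurable_snd.fst)).add measurable_snd.snd)
  continuous_deriv g m := (Diff1Plus.derivative (α (g, m))).continuous.comp
    (continuous_const_add _)
  deriv_pos g m x := Diff1Plus.derivative_pos _ _
  integral_deriv g m := by
    obtain ⟨F, hF, -, -⟩ := (α (g, m)).2
    rw [Diff1Plus.integral_derivative hF, hF.map_add_one]
    ring
  cocycle g h := by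
    filter_upwards [hα.2 g h, hfα h] with m hm hfm x
    obtain ⟨F, hF, -, -⟩ := (α (g, h • m)).2
    obtain ⟨F', hF', -, -⟩ := (α (h, m)).2
    have hFF' : IsIncreasingLift (F'.trans F) (α (g * h, m)).1 := by
      rw [hm]; exact hF.mul hF'
    obtain ⟨n, hn⟩ : ∃ n : ℤ, F' (circleCoord (f m)) = circleCoord (f (h • m)) + n :=
      UnitAddCircle.coe_eq_coe_iff_exists_int.1 (by
        rw [← hF', coe_circleCoord, coe_circleCoord, hfm])
    rw [Diff1Plus.integral_derivative hFF', Diff1Plus.integral_derivative hF',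
      Diff1Plus.integral_derivative hF, OrderIso.trans_apply, OrderIso.trans_apply, hn,
      map_add_intCast_of_map_add_one hF.map_add_one,
      show circleCoord (f (h • m)) + (F' (circleCoord (f m) + x) - (circleCoord (f (h • m)) + n))
        = F' (circleCoord (f m) + x) + (-n : ℤ) by push_cast; ring,
      map_add_intCast_of_map_add_one hF.map_add_one]
    push_cast
    ring

theorem apply_add_eq_cutOpen (hα : IsBorelCocycle μ α) (hf : Measurable f)
    (hfα : IsEquivariantMap μ α f) (g : G) :
    ∀ᵐ m ∂μ, ∀ x : ℝ, (α (g, m)).1 (f m + (x : UnitAddCircle))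
      = f (g • m) + ((cutOpen hα hf hfα).toFun g m x : UnitAddCircle) := by
  filter_upwards [hfα g] with m hm x
  have h := Diff1Plus.apply_coe_add (α (g, m)) (circleCoord (f m)) x
  rw [AddCircle.coe_add, coe_circleCoord] at h
  rw [h, hm]
  rfl

theorem measurable_framing {Ψ : M × ℝ → ℝ≥0∞} (hΨ : Measurable Ψ)
    (hw : ∀ m, IsUnitDensity fun x => Ψ (m, x)) (hf : Measurable f) :
    Measurable (framing (w := fun m x => Ψ (m, x)) hw f) := by
  refine measurable_homeoLebPlus_of_eval fun s => ?_
  obtain ⟨y, rfl⟩ := QuotientAddGroup.mk_surjective s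
  change Measurable fun m => f m + (((hw m).lift.symm y : ℝ) : UnitAddCircle)
  refine hf.add (AddCircle.measurable_mk'.comp (measurable_of_Iic fun x => ?_))
  have e : (fun m => (hw m).lift.symm y) ⁻¹' Iic x = {m | y ≤ (hw m).lift x} := by
    ext m
    exact (hw m).lift.symm_apply_le
  rw [e]
  refine measurableSet_le measurable_const ?_
  simp only [IsUnitDensity.lift_apply, unitCDF, Measure.real,
    unitDensity_Iic _ (Int.fract_lt_one x).le]
  exact (Measurable.lintegral_prod_right' hΨ).ennreal_toReal.const_add _

/-- The framing of an invariant family of fibre densities trivialises the cocycle. -/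
theorem cohomologous_one_of_unitDensity [MeasurableSMul₂ G M] (hα : IsBorelCocycle μ α)
    (hf : Measurable f) (hfα : IsEquivariantMap μ α f) [SFinite μ] {Ψ : M × ℝ → ℝ≥0∞}
    (hΨ : Measurable Ψ) (hw : ∀ m, IsUnitDensity fun x => Ψ (m, x))
    (hinv : ∀ g, ∀ᵐ p ∂μ.prod (volume.restrict (Ioc (0 : ℝ) 1)),
      Ψ (g • p.1, (cutOpen hα hf hfα).toFun g p.1 p.2)
        * ENNReal.ofReal ((cutOpen hα hf hfα).deriv g p.1 p.2) = Ψ p) :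
    Cohomologous μ (fun p => Diff1Plus.toHomeoLeb (α p)) (fun _ => (1 : HomeoLebPlus)) := by
  set β := cutOpen hα hf hfα
  refine ⟨_, measurable_framing hΨ hw hf, fun g => ?_⟩
  have hinv' : ∀ᵐ m ∂μ, ∀ᵐ x ∂volume.restrict (Ioc (0 : ℝ) 1),
      Ψ (g • m, β.toFun g m x) * ENNReal.ofReal (β.deriv g m x) = Ψ (m, x) :=
    Measure.ae_ae_of_ae_prod (hinv g)
  filter_upwards [hinv', apply_add_eq_cutOpen hα hf hfα g] with m hm hαm
  rw [mul_assoc, eq_comm, inv_mul_eq_one, eq_comm]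
  refine Subtype.ext (Homeomorph.ext fun s => ?_)
  obtain ⟨s', rfl⟩ := (hw m).straightening.surjective s
  obtain ⟨x, hx, rfl⟩ := exists_mem_Ioc_coe_eq s'
  change (α (g, m)).1 ((framing hw f m).1 ((hw m).straightening x)) = _
  have hβx : β.toFun g m x ∈ Icc (0 : ℝ) 1 := by
    rw [← β.toFun_zero g m, ← β.toFun_one g m]
    exact ⟨(β.strictMono_toFun g m).monotone hx.1.le, (β.strictMono_toFun g m).monotone hx.2⟩
  have hcdf : unitCDF (fun x => Ψ (m, x)) x = unitCDF (fun y => Ψ (g • m, y)) (β.toFun g m x) := by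
    rw [unitCDF, unitCDF, Measure.real, Measure.real, unitDensity_Iic _ hx.2,
      unitDensity_Iic _ hβx.2, ← β.lintegral_comp_mul g m hx.1.le]
    congr 1
    refine lintegral_congr_ae ?_
    filter_upwards [ae_restrict_of_ae_restrict_of_subset (Ioc_subset_Ioc_right hx.2) hm] with t ht
      using ht.symm
  rw [framing_straightening, hαm, (hw m).straightening_coe (Ioc_subset_Icc_self hx), hcdf,
    ← (hw (g • m)).straightening_coe hβx, framing_straightening hw]

theorem measurePreserving_add_coe [SFinite μ] (hf : Measurable f) :
    MeasurePreserving (fun p : M × ℝ => (p.1, f p.1 + (p.2 : UnitAddCircle)))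
      (μ.prod (volume.restrict (Ioc (0 : ℝ) 1))) (μ.prod volume) := by
  have hmk := measurePreserving_coe_unitAddCircle
  refine (MeasurePreserving.id μ).skew_product
    (g := fun m (x : ℝ) => f m + (x : UnitAddCircle)) ?_ ?_
  · exact (hf.comp measurable_fst).add (hmk.measurable.comp measurable_snd)
  · exact Eventually.of_forall fun m => ((measurePreserving_add_left volume (f m)).comp hmk).map_eq

theorem measurable_skewMap [MeasurableSMul₂ G M] (hα : IsBorelCocycle μ α) (g : G) :
    Measurable (skewMap α g) :=
  (measurable_fst.const_smul g).prodMk (Diff1Plus.measurable_apply.comp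
    ((hα.1.comp (measurable_const.prodMk measurable_fst)).prodMk measurable_snd))

/-- An invariant family of fibre densities integrates to an invariant probability measure on the
skew product. -/
theorem exists_isInvariantProbEquivProd_of_unitDensity [MeasurableSMul₂ G M] [IsFiniteMeasure μ]
    [NeZero μ] [SMulInvariantMeasure G M μ] (hα : IsBorelCocycle μ α)
    (hf : Measurable f) (hfα : IsEquivariantMap μ α f) {Ψ : M × ℝ → ℝ≥0∞}
    (hΨ : Measurable Ψ) (hw : ∀ m, IsUnitDensity fun x => Ψ (m, x))
    (hinv : ∀ g, ∀ᵐ p ∂μ.prod (volume.restrict (Ioc (0 : ℝ) 1)),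
      Ψ (g • p.1, (cutOpen hα hf hfα).toFun g p.1 p.2)
        * ENNReal.ofReal ((cutOpen hα hf hfα).deriv g p.1 p.2) = Ψ p) :
    ∃ ν : Measure (M × UnitAddCircle), IsInvariantProbEquivProd μ α ν := by
  set β := cutOpen hα hf hfα
  set m := μ.prod (volume.restrict (Ioc (0 : ℝ) 1)) with hm
  let S : M × ℝ → M × UnitAddCircle := fun p => (p.1, f p.1 + (p.2 : UnitAddCircle))
  have hS : MeasurePreserving S m (μ.prod volume) := measurePreserving_add_coe hf
  set η := m.withDensity Ψ with hη
  have hηm : η ≪ m := withDensity_absolutelyContinuous _ _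
  have hmη : m ≪ η := by
    refine withDensity_absolutelyContinuous' hΨ.aemeasurable ?_
    have hZ : MeasurableSet {p : M × ℝ | Ψ p ≠ 0} :=
      (measurableSet_eq_fun hΨ measurable_const).compl
    exact (Measure.ae_prod_iff_ae_ae hZ).2 (Eventually.of_forall fun m => (hw m).ae_ne_zero)
  have hηuniv : η univ = μ univ := by
    rw [hη, withDensity_apply _ MeasurableSet.univ, Measure.restrict_univ, hm,
      lintegral_prod _ hΨ.aemeasurable]
    simp only [fun m => (hw m).lintegral_eq_one, lintegral_one]
  have hc0 : μ univ ≠ 0 := NeZero.ne _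
  have hct : μ univ ≠ ∞ := measure_ne_top _ _
  have hTη : ∀ g, MeasurePreserving (fun p : M × ℝ => (g • p.1, β.toFun g p.1 p.2)) η η := by
    intro g
    have hT : Measurable fun p : M × ℝ => (g • p.1, β.toFun g p.1 p.2) :=
      (β.nonsingularAction.hasJacobian g).measurable
    refine ⟨hT, Measure.ext fun s hs => ?_⟩
    rw [Measure.map_apply hT hs, hη, withDensity_apply _ (hT hs), withDensity_apply _ hs,
      ← lintegral_indicator (hT hs), ← lintegral_indicator hs,
      ← (β.nonsingularAction.hasJacobian g).lintegral_comp_mul _ (hΨ.indicator hs)]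
    refine lintegral_congr_ae ?_
    filter_upwards [hinv g] with p hp
    change _ = s.indicator Ψ (g • p.1, β.toFun g p.1 p.2) * ENNReal.ofReal (β.deriv g p.1 p.2)
    by_cases h : (g • p.1, β.toFun g p.1 p.2) ∈ s
    · rw [indicator_of_mem h, hp, indicator_of_mem (show p ∈ _ from h)]
    · rw [indicator_of_notMem h, zero_mul, indicator_of_notMem (show p ∉ _ from h)]
  refine ⟨(μ univ)⁻¹ • η.map S, ⟨?_⟩, fun g => ?_, ?_, ?_⟩
  · rw [Measure.smul_apply, Measure.map_apply hS.measurable MeasurableSet.univ, preimage_univ,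
      hηuniv, smul_eq_mul, ENNReal.inv_mul_cancel hc0 hct]
  · refine MeasurePreserving.smul_measure ⟨measurable_skewMap hα g, ?_⟩ _
    have e : skewMap α g ∘ S =ᵐ[η] S ∘ fun p => (g • p.1, β.toFun g p.1 p.2) := by
      have h : ∀ᵐ p ∂m, ∀ x : ℝ, (α (g, p.1)).1 (f p.1 + (x : UnitAddCircle))
          = f (g • p.1) + (β.toFun g p.1 x : UnitAddCircle) :=
        Measure.quasiMeasurePreserving_fst.ae (apply_add_eq_cutOpen hα hf hfα g)
      filter_upwards [hηm.ae_le h] with p hp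
      exact Prod.ext rfl (hp p.2)
    rw [Measure.map_map (measurable_skewMap hα g) hS.measurable, Measure.map_congr e,
      ← Measure.map_map hS.measurable (hTη g).measurable, (hTη g).map_eq]
  · refine Measure.AbsolutelyContinuous.smul_left ?_ _
    have := hηm.map hS.measurable
    rwa [hS.map_eq] at this
  · refine Measure.AbsolutelyContinuous.smul_right ?_ (ENNReal.inv_ne_zero.2 hct)
    have := hmη.map hS.measurable
    rwa [hS.map_eq] at this

end Straightening

end

theorem corollary5p2
    {G : Type*} [Group G] [TopologicalSpace G] [IsTopologicalGroup G]
    [LocallyCompactSpace G] [T2Space G] [MeasurableSpace G] [BorelSpace G]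
    (hT : KazhdanPropertyT G)
    {M : Type*} [MeasurableSpace M] [StandardBorelSpace M]
    [MulAction G M] [MeasurableSMul₂ G M]
    (μ : Measure M) [IsFiniteMeasure μ] [NeZero μ] [SMulInvariantMeasure G M μ]
    (α : G × M → Diff1Plus) (hα : IsBorelCocycle μ α)
    (f : M → UnitAddCircle) (hf : AEMeasurable f μ) (hfα : IsEquivariantMap μ α f) :
    (∃ ν : Measure (M × UnitAddCircle), IsInvariantProbEquivProd μ α ν) ∧
      Cohomologous μ (fun p => Diff1Plus.toHomeoLeb (α p)) (fun _ => (1 : HomeoLebPlus)) := by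
  have hfα' : IsEquivariantMap μ α (hf.mk f) := fun g => by
    filter_upwards [hfα g, hf.ae_eq_mk,
      (measurePreserving_smul g μ).quasiMeasurePreserving.ae hf.ae_eq_mk] with m h1 h2 h3
    rw [← h2, ← h3, h1]
  obtain ⟨Ψ, hΨ, hw, hinv⟩ :=
    (cutOpen hα hf.measurable_mk hfα').exists_invariant_unitDensity hT
  exact ⟨exists_isInvariantProbEquivProd_of_unitDensity hα hf.measurable_mk hfα' hΨ hw hinv,
    cohomologous_one_of_unitDensity hα hf.measurable_mk hfα' hΨ hw hinv⟩
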